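/- Consider connected, loopless, unweighted multigraphs $G$ (in particular simple graphs) with $n$ vertices, diameter $D$ and maximum degree $\Delta$, used as networks in the CONGEST model: the vertices have distinct identifiers of $O(\log n)$ bits; initially each vertex knows $n$, its own identifier, the identifiers of its neighbours, the number of its edges to each of them, and its private random coins; in each synchronous round every vertex may send a message of $O(\log n)$ bits to each of its neighbours; local computation is unrestricted. An edge cut is a set of edges whose removal disconnects $G$; a vertex cut is a set of vertices whose removal leaves at least two vertices in different components; minimum means of minimum cardinality. Let $\lambda$ be a fixed constant. (1) There is a randomized CONGEST algorithm that, on every such $G$ whose edge connectivity is at most $\lambda$, always terminates within $\mathrm{poly}(D)$ rounds and with high probability (at least $1-n^{-b}$, for any constant $b$ fixed in advance) computes the minimum edge cuts in the following sense: all vertices output one and the same minimum edge cut; in addition each vertex outputs a list of edge sets, all of them minimum edge cuts, such that every minimum edge cut of $G$ is in the list of at least one vertex. (2) There is a randomized CONGEST algorithm that, on every such $G$ that has a vertex cut of size at most $\lambda$, always terminates within $\mathrm{poly}(D\cdot\Delta)$ rounds and with high probability computes the minimum vertex cuts of $G$ in the same sense. The constants in the bounds on message size and on the number of rounds depend only on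 $\lambda$, on $b$ and on the constant in the length of the identifiers; the algorithms are not given $D$, $\Delta$ or the connectivity of $G$. -/

import Mathlib

/-! ### Finite unweighted multigraphs and their cuts -/

/-- A loopless unweighted multigraph on `V`: `mult s(u, v)` is the number of parallel edges
between `u` and `v`. A simple graph is the case where all multiplicities are at most `1`. -/
structure Multigraph (V : Type) where
  mult : Sym2 V → ℕ
  mult_diag : ∀ v, mult s(v, v) = 0

namespace Multigraph

variable {V : Type} (G : Multigraph V)

/-- The underlying simple graph: `u` and `v` are neighbours when some edge joins them. -/
def graph : SimpleGraph V :=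
  SimpleGraph.fromEdgeSet {p | 0 < G.mult p}

/-- The pair `(p, k)` names the `k`-th of the `mult p` parallel edges with end points `p`. -/
def edges : Set (Sym2 V × ℕ) :=
  {e | e.2 < G.mult e.1}

/-- The underlying simple graph of `G ∖ F`: `u` and `v` are adjacent when at least one
edge between them is left after the edges in `F` are removed. -/
def deleteEdges (F : Finset (Sym2 V × ℕ)) : SimpleGraph V :=
  SimpleGraph.fromEdgeSet {p | ∃ k, (p, k) ∈ G.edges ∧ (p, k) ∉ F}

/-- A set of edges whose removal disconnects the graph. -/
def IsEdgeCut (F : Finset (Sym2 V × ℕ)) : Prop :=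
  (F : Set (Sym2 V × ℕ)) ⊆ G.edges ∧ ¬ (G.deleteEdges F).Preconnected

/-- A set of vertices whose removal leaves at least two vertices that are not connected
with each other. -/
def IsVertexCut (S : Finset V) : Prop :=
  ¬ (G.graph.induce {v | v ∉ S}).Preconnected

/-- An edge cut of minimum cardinality. -/
def IsMinEdgeCut (F : Finset (Sym2 V × ℕ)) : Prop :=
  G.IsEdgeCut F ∧ ∀ F', G.IsEdgeCut F' → F.card ≤ F'.card

/-- A vertex cut of minimum cardinality. -/
def IsMinVertexCut (S : Finset V) : Prop :=
  G.IsVertexCut S ∧ ∀ S', G.IsVertexCut S' → S.card ≤ S'.card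

/-- The smallest size of an edge cut, `⊤` if there is none (that is, on a single vertex). -/
noncomputable def edgeConnectivity : ℕ∞ :=
  ⨅ F : {F : Finset (Sym2 V × ℕ) // G.IsEdgeCut F}, (F.1.card : ℕ∞)

/-- The smallest size of a vertex cut, `⊤` if there is none (that is, if any two distinct
vertices are neighbours). -/
noncomputable def vertexConnectivity : ℕ∞ :=
  ⨅ S : {S : Finset V // G.IsVertexCut S}, (S.1.card : ℕ∞)

/-- The number of edges at `v`, parallel edges counted separately. -/
def degree [Fintype V] (v : V) : ℕ :=
  ∑ u, G.mult s(v, u)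

def maxDegree [Fintype V] : ℕ :=
  Finset.univ.sup G.degree

/-- The diameter (the theorem uses it for connected graphs only). -/
noncomputable def diam : ℕ :=
  G.graph.diam

end Multigraph

/-! ### The CONGEST model -/

/-- The program that every node runs, for messages of `k` bits and local outputs in `Out`.
Nodes are addressed by their numerical identifiers; local computation is unrestricted.
* `init i m r` is the initial state of the node with identifier `i` whose random coins are `r`,
  where `m j` is the number of edges between that node and the node with identifier `j`
  (`0` if there is no such neighbour);
* `send s j` is the message for the neighbour `j` when the state is `s`;
* `recv s m` is the state after a round, where `m j` is the message received from neighbour `j`;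
* `out s` is the output of a node in state `s`; the node halts as soon as this is not `none`. -/
structure CongestProgram (Out : Type) (k : ℕ) where
  State : Type
  coins : ℕ
  init : ℕ → (ℕ → ℕ) → (Fin coins → Bool) → State
  send : State → ℕ → (Fin k → Bool)
  recv : State → (ℕ → (Fin k → Bool)) → State
  out : State → Option Out

namespace CongestProgram

variable {Out : Type} {k : ℕ} (P : CongestProgram Out k)
variable {V : Type} (G : Multigraph V) (ids : V ↪ ℕ)

/-- The outcomes of all coins: every node has private coins. -/
abbrev Tape (V : Type) : Type := V → Fin P.coins → Bool

/-- What a node knows about its edges at the start: the number of edges to each identifier. -/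
noncomputable def links (v : V) : ℕ → ℕ :=
  Function.extend ids (fun u => G.mult s(v, u)) 0

open Classical in
/-- The messages that `v` receives in a round, by identifier of the sender. A halted node and
an identifier that belongs to no neighbour of `v` send nothing (the zero message). -/
noncomputable def inbox (σ : V → P.State) (v : V) : ℕ → (Fin k → Bool) :=
  Function.extend ids
    (fun u => if G.graph.Adj v u ∧ P.out (σ u) = none then P.send (σ u) (ids v)
      else fun _ => false)
    (fun _ _ => false)

open Classical in
/-- The states of all nodes after `t` synchronous rounds; halted nodes keep their state. -/
noncomputable def run (ω : P.Tape V) : ℕ → V → P.State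
  | 0 => fun v => P.init (ids v) (links G ids v) (ω v)
  | t + 1 => fun v =>
      if P.out (run ω t v) = none then P.recv (run ω t v) (P.inbox G ids (run ω t) v)
      else run ω t v

/-- The outputs of all nodes after `t` rounds (`none` for a node that has not halted yet). -/
noncomputable def outputs (ω : P.Tape V) (t : ℕ) (v : V) : Option Out :=
  P.out (P.run G ids ω t v)

/-- All nodes have halted within `t` rounds, whatever the coins. -/
def HaltsWithin (t : ℕ) : Prop :=
  ∀ (ω : P.Tape V) (v : V), P.outputs G ids ω t v ≠ none

/-- The probability of an event when all coins of all nodes are fair and independent. -/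
noncomputable def prob (V : Type) (E : P.Tape V → Prop) : ℝ :=
  (Nat.card {ω : P.Tape V // E ω} : ℝ) / Nat.card (P.Tape V)

end CongestProgram

/-! ### The output of a minimum cut algorithm -/

/-- The local output of a node: one cut, and all the cuts that the node has learned;
the elements of the cuts are given by names in `N`. -/
structure CutOutput (N : Type) where
  cut : Finset N
  known : Finset (Finset N)

/-- All nodes output one and the same minimum cut, every cut that a node claims to have learned
is a minimum cut, and each minimum cut has been learned by some node. -/
def SolvesMinCut {V X N : Type} [DecidableEq N] (IsMinCut : Finset X → Prop) (name : X → N)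
    (out : V → Option (CutOutput N)) : Prop :=
  ∃ o : V → CutOutput N, (∀ v, out v = some (o v)) ∧
    (∃ C, IsMinCut C ∧ ∀ v, (o v).cut = C.image name) ∧
    (∀ v, ∀ Y ∈ (o v).known, ∃ C, IsMinCut C ∧ Y = C.image name) ∧
    (∀ C, IsMinCut C → ∃ v, C.image name ∈ (o v).known)

/-- An edge is named by the identifiers of its end points and its number among the parallel
edges between them. -/
def edgeName {V : Type} (ids : V ↪ ℕ) (e : Sym2 V × ℕ) : Sym2 ℕ × ℕ :=
  (e.1.map ids, e.2)

/-!
Both algorithms are deterministic: they use no coins and succeed with certainty, which is stronger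
than success with high probability.

*Knowing the cuts.* Fix a source `s`. A set `F` of at most `Λ` elements (edges or vertices)
separates `s` from `v` iff it meets the element set of every walk from `s` to `v`. There are too
many walks for `v` to know them all, but not all are needed: among sets of size at most `t`,
`(t + 1) ^ Λ` of them suffice so that whenever some member of the whole family avoids `F`, one of
the chosen ones does (`exists_representative`, a branching argument). In each round, every node
hears the walks that its neighbours know, extends them by one step, and keeps a representative
subfamily. This never loses information about walks of length at most the number of rounds
(`walkFamily_complete`), and the families have size polynomial in that number, so they are sent in
polynomially many messages of `O(log n)` bits, with no factor that depends on `n`.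

*Short walks suffice.* If `G` has radius at most `R`, then a walk from any vertex to the centre
either survives the removal of `F` or leads to an end of a removed edge (a neighbour of a removed
vertex). Hence what is left is covered by `2Λ + 1` (respectively `ΛΔ + 1`) balls of radius `R`,
and shortest walks in it have length polynomial in `R` (respectively in `R` and `Δ`), by
`exists_short_walk`. So after polynomially many rounds `v` can tell which sets separate it from `s`
(`forall_not_disjoint_iff`). A removed vertex cannot serve as source. Therefore the walks
from the `Λ + 1` smallest identifiers are kept, and the smallest one outside `F` is the source for
`F` (`exists_pivot`). Each minimum cut consists of elements of walks known to a node that it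
separates from this source (`exists_mem_candidates`). Flooding the least candidate then gives all
nodes the same minimum cut (`result_spec`).

*Guessing the parameter.* The nodes do not know `D` and `Δ`, so they try `R = 0, 1, 2, …`.
In phase `R` a node compares the smallest identifier within distance `R` with that of its
neighbours. If these identifiers agree everywhere, the graph has radius at most `R`. If not, every
node is within distance `2 * R` of a disagreement, so that all nodes learn of the failure
in `2 * R` further rounds and go on together to the next phase (`phase_dichotomy`).
Phase `R = D` (respectively `R = D * Δ`) succeeds at the latest.
-/

/-! ### Representative families -/

/-- Every family of sets of size at most `t` has at most `(t + 1) ^ k` members that represent it: if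
a member of the family avoids a set `F` of size at most `k`, one of the chosen sets does. -/
theorem exists_representative {α : Type} [DecidableEq α] (t k : ℕ) (A : Set (Finset α))
    (hA : ∀ P ∈ A, P.card ≤ t) :
    ∃ B : Finset (Finset α), (∀ P ∈ B, P ∈ A) ∧ B.card ≤ (t + 1) ^ k ∧
      ∀ P ∈ A, ∀ F : Finset α, F.card ≤ k → Disjoint P F → ∃ Q ∈ B, Disjoint Q F := by
  induction k generalizing A with
  | zero =>
    rcases A.eq_empty_or_nonempty with rfl | ⟨P, hP⟩
    · exact ⟨∅, by simp⟩
    · refine ⟨{P}, by simpa using hP, by simp, fun _ _ F hF _ => ⟨P, by simp, ?_⟩⟩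
      rw [Finset.card_eq_zero.mp (Nat.le_zero.mp hF)]
      exact Finset.disjoint_empty_right _
  | succ k ih =>
    rcases A.eq_empty_or_nonempty with rfl | ⟨P, hP⟩
    · exact ⟨∅, by simp⟩
    -- A set `F` that meets `P` contains some `e ∈ P`; then only the sets without `e` matter,
    -- and they have to avoid one element less.
    choose B hBA hBc hB using fun e : α =>
      ih {Q | Q ∈ A ∧ e ∉ Q} (fun Q hQ => hA Q hQ.1)
    refine ⟨insert P (P.biUnion B), ?_, ?_, ?_⟩
    · intro Q hQ
      rcases Finset.mem_insert.mp hQ with rfl | hQ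
      · exact hP
      · obtain ⟨e, _, he⟩ := Finset.mem_biUnion.mp hQ
        exact (hBA e Q he).1
    · calc (insert P (P.biUnion B)).card ≤ (P.biUnion B).card + 1 := Finset.card_insert_le _ _
        _ ≤ P.card * (t + 1) ^ k + 1 := by
          gcongr
          exact Finset.card_biUnion_le_card_mul _ _ _ fun e _ => hBc e
        _ ≤ t * (t + 1) ^ k + (t + 1) ^ k := by
          gcongr
          · exact hA P hP
          · exact Nat.one_le_pow _ _ (by omega)
        _ = (t + 1) ^ (k + 1) := by ring
    · intro Q hQ F hF hQF
      by_cases hPF : Disjoint P F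
      · exact ⟨P, Finset.mem_insert_self _ _, hPF⟩
      obtain ⟨e, heP, heF⟩ := Finset.not_disjoint_iff.mp hPF
      have heQ : e ∉ Q := fun h => Finset.disjoint_left.mp hQF h heF
      obtain ⟨Q', hQ', hd⟩ := hB e Q ⟨hQ, heQ⟩ (F.erase e)
        (by rw [Finset.card_erase_of_mem heF]; omega)
        (hQF.mono_right (Finset.erase_subset _ _))
      refine ⟨Q', Finset.mem_insert_of_mem (Finset.mem_biUnion.mpr ⟨e, heP, hQ'⟩), ?_⟩
      rw [Finset.disjoint_left] at hd ⊢
      intro x hx hxF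
      by_cases hxe : x = e
      · exact (hBA e Q' hQ').2 (hxe ▸ hx)
      · exact hd hx (Finset.mem_erase.mpr ⟨hxe, hxF⟩)

/-- The sources that occur in a family of pairs `(m, P)`, where `m` is the identifier of the source
of a walk and `P` is the set of the elements that the walk uses. -/
def sources {α : Type} (A : Set (ℕ × Finset α)) : Set ℕ :=
  {m | ∃ P, (m, P) ∈ A}

/-- A version of `exists_representative` for the walks from the `k + 1` smallest sources. -/
theorem exists_compressed {α : Type} [DecidableEq α] (t k : ℕ) (A : Set (ℕ × Finset α))
    (hA : ∀ x ∈ A, x.2.card ≤ t) :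
    ∃ B : Finset (ℕ × Finset α), (∀ x ∈ B, x ∈ A) ∧ B.card ≤ (k + 1) * (t + 1) ^ k ∧
      ∀ m P (F : Finset α), (m, P) ∈ A → {m' ∈ sources A | m' < m}.ncard ≤ k → F.card ≤ k →
        Disjoint P F → ∃ Q, (m, Q) ∈ B ∧ Disjoint Q F := by
  classical
  set M : Set ℕ := {m | m ∈ sources A ∧ {m' ∈ sources A | m' < m}.ncard ≤ k} with hM
  have hfin : ∀ m, {m' ∈ sources A | m' < m}.Finite := fun m =>
    (Set.finite_Iio m).subset fun _ h => h.2
  -- The number of smaller sources tells the sources in `M` apart.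
  have hinj : Set.InjOn (fun m => {m' ∈ sources A | m' < m}.ncard) M := by
    have hlt : ∀ a ∈ M, ∀ b ∈ M, a < b →
        {m' ∈ sources A | m' < a}.ncard < {m' ∈ sources A | m' < b}.ncard := by
      intro a ha b _ hab
      refine Set.ncard_lt_ncard ⟨fun x hx => ⟨hx.1, hx.2.trans hab⟩, fun h => ?_⟩ (hfin b)
      exact lt_irrefl a (h (a := a) ⟨ha.1, hab⟩).2
    intro a ha b hb hab
    rcases lt_trichotomy a b with h | h | h
    · exact absurd hab (hlt a ha b hb h).ne
    · exact h
    · exact absurd hab (hlt b hb a ha h).ne'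
  have hmaps : Set.MapsTo (fun m => {m' ∈ sources A | m' < m}.ncard) M
      (Finset.range (k + 1) : Finset ℕ) := fun m hm => by
    have := hm.2
    simp only [Finset.coe_range, Set.mem_Iio]; omega
  have hMfin : M.Finite := Set.Finite.of_injOn hmaps hinj (Finset.finite_toSet _)
  have hMcard : hMfin.toFinset.card ≤ k + 1 := by
    have := Finset.card_le_card_of_injOn (s := hMfin.toFinset) (t := Finset.range (k + 1)) _
      (by simpa using hmaps) (by simpa using hinj)
    simpa using this
  choose B hBA hBc hB using fun m : ℕ =>
    exists_representative t k {P | (m, P) ∈ A} (fun P hP => hA _ hP)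
  refine ⟨hMfin.toFinset.biUnion fun m => (B m).image fun P => (m, P), ?_, ?_, ?_⟩
  · intro x hx
    obtain ⟨m, _, hx⟩ := Finset.mem_biUnion.mp hx
    obtain ⟨P, hP, rfl⟩ := Finset.mem_image.mp hx
    exact hBA m P hP
  · refine (Finset.card_biUnion_le_card_mul _ _ _ fun m _ =>
      Finset.card_image_le.trans (hBc m)).trans ?_
    gcongr
  · intro m P F hP hm hF hd
    obtain ⟨Q, hQ, hQF⟩ := hB m P hP F hF hd
    refine ⟨Q, Finset.mem_biUnion.mpr ⟨m, ?_, Finset.mem_image_of_mem _ hQ⟩, hQF⟩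
    simpa using ⟨⟨P, hP⟩, hm⟩

open Classical in
/-- A small subfamily of `A` that represents, for each of the `k + 1` smallest sources, the walks
from this source with respect to the removal of at most `k` elements. It is meant for families
of sets of size at most `t`, and is empty (a junk value) for other families. -/
noncomputable def compress {α : Type} (t k : ℕ) (A : Set (ℕ × Finset α)) :
    Finset (ℕ × Finset α) :=
  if h : ∀ x ∈ A, x.2.card ≤ t then (exists_compressed t k A h).choose else ∅

section compress

variable {α : Type} {t k : ℕ} {A : Set (ℕ × Finset α)}

theorem mem_of_mem_compress {x : ℕ × Finset α} (hx : x ∈ compress t k A) : x ∈ A := by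
  classical
  unfold compress at hx
  split_ifs at hx with h
  · exact (exists_compressed t k A h).choose_spec.1 x hx
  · simp at hx

theorem card_compress_le : (compress t k A).card ≤ (k + 1) * (t + 1) ^ k := by
  classical
  unfold compress
  split_ifs with h
  · exact (exists_compressed t k A h).choose_spec.2.1
  · simp

theorem exists_mem_compress (hA : ∀ x ∈ A, x.2.card ≤ t) {m : ℕ} {P F : Finset α}
    (hP : (m, P) ∈ A) (hm : {m' ∈ sources A | m' < m}.ncard ≤ k) (hF : F.card ≤ k)
    (hd : Disjoint P F) : ∃ Q, (m, Q) ∈ compress t k A ∧ Disjoint Q F := by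
  classical
  unfold compress
  rw [dif_pos hA]
  exact (exists_compressed t k A hA).choose_spec.2.2 m P F hP hm hF hd

end compress

/-! ### Short walks in a graph that is covered by few balls -/

/-- If each vertex in the component of `s` has a walk of length at most `d` to one of the vertices
in `Z`, then every walk from `s` can be shortened to length at most `Z.card * (2 * d + 1)`:
of any more vertices that lie `2 * d + 1` steps apart on a shortest walk, two share a vertex of `Z`,
which gives a shortcut. -/
theorem exists_short_walk {V : Type} {H : SimpleGraph V} {s v : V} (hsv : H.Reachable s v)
    (Z : Finset V) (d : ℕ)
    (hZ : ∀ x, H.Reachable s x → ∃ z ∈ Z, ∃ p : H.Walk x z, p.length ≤ d) :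
    ∃ p : H.Walk v s, p.length ≤ Z.card * (2 * d + 1) := by
  obtain ⟨p, hp⟩ := hsv.exists_walk_length_eq_dist
  refine ⟨p.reverse, ?_⟩
  rw [SimpleGraph.Walk.length_reverse]
  by_contra! hlong
  choose f hfZ q hq using fun i : ℕ => hZ (p.getVert (i * (2 * d + 1))) ⟨p.take _⟩
  obtain ⟨i, hi, j, hj, hij, hf⟩ := Finset.exists_ne_map_eq_of_card_lt_of_maps_to
    (s := Finset.range (Z.card + 1)) (t := Z) (by simp) (f := f) (fun i _ => hfZ i)
  wlog hlt : i < j generalizing i j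
  · exact this j hj i hi hij.symm hf.symm (by omega)
  have hjZ : j * (2 * d + 1) ≤ Z.card * (2 * d + 1) :=
    Nat.mul_le_mul_right _ (by simpa [Nat.lt_succ_iff] using hj)
  have hmul : (i + 1) * (2 * d + 1) ≤ j * (2 * d + 1) := Nat.mul_le_mul_right _ hlt
  have hshort := SimpleGraph.dist_le
    (((p.take (i * (2 * d + 1))).append (q i)).append
      (((q j).copy rfl hf.symm).reverse.append (p.drop (j * (2 * d + 1)))))
  have h1 := hq i
  have h2 := hq j
  simp only [SimpleGraph.Walk.length_append, SimpleGraph.Walk.take_length,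
    SimpleGraph.Walk.drop_length, SimpleGraph.Walk.length_reverse,
    SimpleGraph.Walk.length_copy] at hshort
  rw [add_mul] at hmul
  omega

/-! ### Synchronous protocols with long messages, and their compilation to CONGEST programs -/

/-- What a node knows at the start: its identifier and the number of its edges to each
identifier. -/
abbrev NodeInfo : Type :=
  ℕ × (ℕ → ℕ)

/-- A deterministic protocol that runs in phases `0, 1, 2, …`. In every round of a phase each node
sends its whole state to its neighbours; `step R i I x m` is the state after round `i` of
phase `R` for a node with initial knowledge `I` and state `x`, where `m j` is the state of the
neighbour with identifier `j` (`none` if there is no such neighbour). A phase starts afresh from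
the initial knowledge. It has `rounds R` rounds, after which `result` either provides an output or
(value `none`) makes the node go on to the next phase. -/
structure PhasedProtocol (Out : Type) where
  State : Type
  start : ℕ → NodeInfo → State
  step : ℕ → ℕ → NodeInfo → State → (ℕ → Option State) → State
  rounds : ℕ → ℕ
  result : ℕ → NodeInfo → State → Option Out

section semantics

variable {V : Type} (G : Multigraph V) (ids : V ↪ ℕ)

/-- What the node `v` knows at the start. -/
noncomputable def nodeInfo (v : V) : NodeInfo :=
  (ids v, CongestProgram.links G ids v)

open Classical in
/-- The values `x u` at the neighbours `u` of `v`, by identifier. -/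
noncomputable def heard {X : Type} (x : V → X) (v : V) : ℕ → Option X :=
  Function.extend ids (fun u => if G.graph.Adj v u then some (x u) else none) (fun _ => none)

/-- The states of all nodes after `i` rounds of phase `R`. -/
noncomputable def PhasedProtocol.config {Out : Type} (A : PhasedProtocol Out) (R : ℕ) :
    ℕ → V → A.State
  | 0 => fun v => A.start R (nodeInfo G ids v)
  | i + 1 => fun v =>
      A.step R i (nodeInfo G ids v) (A.config R i v) (heard G ids (A.config R i) v)

variable {G ids}

theorem Multigraph.graph_adj {v u : V} : G.graph.Adj v u ↔ 0 < G.mult s(v, u) := by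
  rw [Multigraph.graph, SimpleGraph.fromEdgeSet_adj, Set.mem_ofPred_eq, and_iff_left_iff_imp]
  rintro h rfl
  simp [G.mult_diag] at h

theorem links_apply (v u : V) : CongestProgram.links G ids v (ids u) = G.mult s(v, u) :=
  ids.injective.extend_apply _ _ _

theorem links_eq_zero {v : V} {j : ℕ} (hj : ¬ ∃ u, ids u = j) :
    CongestProgram.links G ids v j = 0 :=
  Function.extend_apply' _ _ _ hj

theorem heard_eq_some {X : Type} {x : V → X} {v : V} {j : ℕ} {y : X} :
    heard G ids x v j = some y ↔ ∃ u, ids u = j ∧ G.graph.Adj v u ∧ x u = y := by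
  classical
  by_cases hj : ∃ u, ids u = j
  · obtain ⟨u, rfl⟩ := hj
    rw [heard, ids.injective.extend_apply]
    constructor
    · intro h
      split_ifs at h with ha
      exact ⟨u, rfl, ha, by simpa using h⟩
    · rintro ⟨u', hu', ha, rfl⟩
      obtain rfl := ids.injective hu'
      simp [ha]
  · rw [heard, Function.extend_apply' _ _ _ hj]
    constructor
    · simp
    · rintro ⟨u, hu, _⟩
      exact (hj ⟨u, hu⟩).elim

end semantics

/-- The state of a node in the compiled program: the phase, the round, the index of the current
chunk, the chunks received so far in this round (by sender and index), the protocol state,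
and the output. -/
structure ChunkState (Out St : Type) (k : ℕ) where
  info : NodeInfo
  phase : ℕ
  round : ℕ
  chunk : ℕ
  buffer : ℕ → ℕ → (Fin k → Bool)
  state : St
  output : Option Out

namespace PhasedProtocol

variable {Out : Type} {k : ℕ} (A : PhasedProtocol Out) (w : ℕ → ℕ)
  (enc : ℕ → A.State → ℕ → (Fin k → Bool)) (dec : ℕ → (ℕ → (Fin k → Bool)) → A.State)

/-- The beginning of a phase. -/
def phaseStart (R : ℕ) (I : NodeInfo) : ChunkState Out A.State k :=
  ⟨I, R, 0, 0, fun _ _ _ => false, A.start R I, none⟩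

/-- The end of a round, in which the states that `buf` encodes have been received. -/
def endRound (s : ChunkState Out A.State k) (buf : ℕ → ℕ → (Fin k → Bool)) :
    ChunkState Out A.State k :=
  let x := A.step s.phase s.round s.info s.state
    fun j => if 0 < s.info.2 j then some (dec s.phase (buf j)) else none
  if s.round + 1 < A.rounds s.phase then
    ⟨s.info, s.phase, s.round + 1, 0, fun _ _ _ => false, x, none⟩
  else match A.result s.phase s.info x with
    | some o => { s with output := some o }
    | none => A.phaseStart (s.phase + 1) s.info

/-- The program that simulates a phased protocol with messages of `k` bits. A state is sent in
`w R` chunks in phase `R`; chunk `c` of the state `x` is `enc R x c`, and `dec R` restores the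
state from its chunks. The program uses no coins. -/
@[reducible]
def compile : CongestProgram Out k where
  State := ChunkState Out A.State k
  coins := 0
  init i m _ := A.phaseStart 0 (i, m)
  send s _ := enc s.phase s.state s.chunk
  recv s m :=
    let buf : ℕ → ℕ → (Fin k → Bool) := fun j c => if c = s.chunk then m j else s.buffer j c
    if s.chunk + 1 < w s.phase then { s with chunk := s.chunk + 1, buffer := buf }
    else A.endRound dec s buf
  out s := s.output

variable {A w enc dec} {V : Type} {G : Multigraph V} {ids : V ↪ ℕ}
  {ω : (A.compile w enc dec).Tape V} {R : ℕ}

open Classical in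
theorem _root_.CongestProgram.run_succ {P : CongestProgram Out k} {ω : P.Tape V} {t : ℕ}
    {σ : V → P.State} (h : P.run G ids ω t = σ) (hσ : ∀ u, P.out (σ u) = none) (v : V) :
    P.run G ids ω (t + 1) v = P.recv (σ v) (Function.extend ids
      (fun u => if G.graph.Adj v u then P.send (σ u) (ids v) else fun _ => false)
      (fun _ _ => false)) := by
  subst h
  simp [CongestProgram.run, CongestProgram.inbox, hσ]

open Classical in
/-- Within a round all nodes are in step: after `c` messages each node has received the first `c`
chunks of the states of its neighbours. -/
theorem run_chunk {t i : ℕ} {x : V → A.State}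
    (h0 : (A.compile w enc dec).run G ids ω t =
      fun v => ⟨nodeInfo G ids v, R, i, 0, fun _ _ _ => false, x v, none⟩) {c : ℕ} (hc : c < w R) :
    (A.compile w enc dec).run G ids ω (t + c) = fun v => ⟨nodeInfo G ids v, R, i, c,
      fun j d => if d < c then Function.extend ids
        (fun u => if G.graph.Adj v u then enc R (x u) d else fun _ => false) (fun _ _ => false) j
        else fun _ => false, x v, none⟩ := by
  induction c with
  | zero => simpa using h0
  | succ c ih =>
    have ih := ih (by omega)
    funext v
    rw [← add_assoc, CongestProgram.run_succ ih (fun _ => rfl)]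
    simp only [hc, if_true]
    congr 1
    funext j d
    rcases lt_trichotomy d c with h | rfl | h
    · simp [h, h.ne, h.trans (Nat.lt_succ_self c)]
    · simp
    · simp [h.ne', not_lt.mpr h.le, show ¬ d < c + 1 by omega]

open Classical in
theorem run_round (hw : 0 < w R) {t i : ℕ} {x : V → A.State}
    (hx : ∀ v, dec R (enc R (x v)) = x v)
    (henc : ∀ y c, w R ≤ c → enc R y c = fun _ => false)
    (h0 : (A.compile w enc dec).run G ids ω t =
      fun v => ⟨nodeInfo G ids v, R, i, 0, fun _ _ _ => false, x v, none⟩) (v : V) :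
    ∃ c b, (A.compile w enc dec).run G ids ω (t + w R) v =
      if i + 1 < A.rounds R then
        ⟨nodeInfo G ids v, R, i + 1, 0, fun _ _ _ => false,
          A.step R i (nodeInfo G ids v) (x v) (heard G ids x v), none⟩
      else match A.result R (nodeInfo G ids v)
          (A.step R i (nodeInfo G ids v) (x v) (heard G ids x v)) with
        | some o => ⟨nodeInfo G ids v, R, i, c, b, x v, some o⟩
        | none => A.phaseStart (R + 1) (nodeInfo G ids v) := by
  obtain ⟨c, hc⟩ : ∃ c, w R = c + 1 := ⟨w R - 1, by omega⟩
  have h1 := run_chunk h0 (c := c) (by omega)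
  rw [hc, ← add_assoc, CongestProgram.run_succ h1 (fun _ => rfl)]
  simp only [hc, lt_irrefl, if_false, endRound]
  have hheard : (fun j => if 0 < (nodeInfo G ids v).2 j then
      some (dec R fun d => if d = c then Function.extend ids
        (fun u => if G.graph.Adj v u then enc R (x u) c else fun _ => false) (fun _ _ => false) j
        else if d < c then Function.extend ids
        (fun u => if G.graph.Adj v u then enc R (x u) d else fun _ => false) (fun _ _ => false) j
        else fun _ => false) else none) = heard G ids x v := by
    funext j
    by_cases hj : ∃ u, ids u = j
    · obtain ⟨u, rfl⟩ := hj
      simp only [nodeInfo, links_apply, ← Multigraph.graph_adj, heard, ids.injective.extend_apply]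
      split_ifs with ha
      · congr 1
        rw [← hx u]
        congr 1
        funext d
        rw [hx u]
        split_ifs with h2 h3
        · rw [h2]
        · rfl
        · rw [henc _ _ (by omega)]
      · rfl
    · simp [nodeInfo, links_eq_zero hj, heard, Function.extend_apply' _ _ _ hj]
  rw [hheard]
  exact ⟨_, _, rfl⟩

theorem run_config (hw : 0 < w R)
    (henc : ∀ y c, w R ≤ c → enc R y c = fun _ => false)
    (hx : ∀ i < A.rounds R, ∀ v : V, dec R (enc R (A.config G ids R i v)) = A.config G ids R i v)
    {t : ℕ} (h0 : (A.compile w enc dec).run G ids ω t =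
      fun v => A.phaseStart R (nodeInfo G ids v)) {i : ℕ} (hi : i < A.rounds R) :
    (A.compile w enc dec).run G ids ω (t + i * w R) =
      fun v => ⟨nodeInfo G ids v, R, i, 0, fun _ _ _ => false, A.config G ids R i v, none⟩ := by
  induction i with
  | zero =>
    rw [zero_mul, add_zero, h0]
    rfl
  | succ i ih =>
    funext v
    obtain ⟨c, b, h⟩ := run_round hw (hx i (by omega)) henc (ih (by omega)) v
    rw [add_mul, one_mul, ← add_assoc, h, if_pos hi]
    rfl

theorem run_phase (hw : 0 < w R)
    (henc : ∀ y c, w R ≤ c → enc R y c = fun _ => false)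
    (hr : 0 < A.rounds R)
    (hx : ∀ i < A.rounds R, ∀ v : V, dec R (enc R (A.config G ids R i v)) = A.config G ids R i v)
    {t : ℕ} (h0 : (A.compile w enc dec).run G ids ω t =
      fun v => A.phaseStart R (nodeInfo G ids v)) (v : V) :
    (A.result R (nodeInfo G ids v) (A.config G ids R (A.rounds R) v) = none →
      (A.compile w enc dec).run G ids ω (t + A.rounds R * w R) v =
        A.phaseStart (R + 1) (nodeInfo G ids v)) ∧
    ((A.compile w enc dec).outputs G ids ω (t + A.rounds R * w R) v =
      A.result R (nodeInfo G ids v) (A.config G ids R (A.rounds R) v)) := by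
  obtain ⟨i, hi⟩ : ∃ i, A.rounds R = i + 1 := ⟨A.rounds R - 1, by omega⟩
  obtain ⟨c, b, h⟩ := run_round hw (hx i (by omega)) henc
    (run_config hw henc hx h0 (i := i) (by omega)) v
  rw [hi, if_neg (lt_irrefl _)] at h
  have hcfg : A.step R i (nodeInfo G ids v) (A.config G ids R i v)
      (heard G ids (A.config G ids R i) v) = A.config G ids R (i + 1) v := rfl
  rw [hcfg] at h
  rw [hi, CongestProgram.outputs, add_mul, one_mul, ← add_assoc, h]
  cases A.result R (nodeInfo G ids v) (A.config G ids R (i + 1) v) with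
  | none => exact ⟨fun _ => rfl, rfl⟩
  | some o => exact ⟨fun h => by simp at h, rfl⟩

end PhasedProtocol

theorem CongestProgram.outputs_of_le {Out : Type} {k : ℕ} {P : CongestProgram Out k} {V : Type}
    {G : Multigraph V} {ids : V ↪ ℕ} {ω : P.Tape V} {t t' : ℕ} (htt : t ≤ t') {v : V}
    (h : P.outputs G ids ω t v ≠ none) : P.outputs G ids ω t' v = P.outputs G ids ω t v := by
  induction t', htt using Nat.le_induction with
  | base => rfl
  | succ t' _ ih =>
    have h' : P.out (P.run G ids ω t' v) ≠ none := by
      rw [← CongestProgram.outputs, ih]; exact h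
    rw [← ih]
    simp only [CongestProgram.outputs, CongestProgram.run, if_neg h']

/-- If no node has a result in the phases before `R₀`, and every node has one in phase `R₀`, then
the compiled program outputs these results. -/
theorem PhasedProtocol.outputs_compile {Out : Type} {k : ℕ} {A : PhasedProtocol Out} {w : ℕ → ℕ}
    {enc : ℕ → A.State → ℕ → (Fin k → Bool)} {dec : ℕ → (ℕ → (Fin k → Bool)) → A.State}
    {V : Type} {G : Multigraph V} {ids : V ↪ ℕ}
    (hw : ∀ R, 0 < w R) (hr : ∀ R, 0 < A.rounds R)
    (henc : ∀ R y c, w R ≤ c → enc R y c = fun _ => false)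
    (hx : ∀ R, ∀ i < A.rounds R, ∀ v : V,
      dec R (enc R (A.config G ids R i v)) = A.config G ids R i v)
    {R₀ : ℕ} {o : V → Out}
    (hnone : ∀ R < R₀, ∀ v, A.result R (nodeInfo G ids v) (A.config G ids R (A.rounds R) v) = none)
    (hsome : ∀ v, A.result R₀ (nodeInfo G ids v) (A.config G ids R₀ (A.rounds R₀) v) = some (o v))
    (ω : (A.compile w enc dec).Tape V) {t : ℕ}
    (ht : ∑ R ∈ Finset.range (R₀ + 1), A.rounds R * w R ≤ t) (v : V) :
    (A.compile w enc dec).outputs G ids ω t v = some (o v) := by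
  have hstart : ∀ R ≤ R₀, (A.compile w enc dec).run G ids ω
      (∑ R ∈ Finset.range R, A.rounds R * w R) = fun v => A.phaseStart R (nodeInfo G ids v) := by
    intro R hR
    induction R with
    | zero => rfl
    | succ R ih =>
      funext v
      rw [Finset.sum_range_succ]
      exact (run_phase (hw R) (henc R) (hr R) (hx R) (ih (by omega)) v).1 (hnone R (by omega) v)
  have h := (run_phase (hw R₀) (henc R₀) (hr R₀) (hx R₀) (hstart R₀ le_rfl) v).2
  rw [hsome v, ← Finset.sum_range_succ (fun R => A.rounds R * w R)] at h
  rw [CongestProgram.outputs_of_le ht (by rw [h]; simp), h]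

/-! ### Codes for messages -/

/-- Few states can be encoded by `w` messages of `k` bits; the messages after these are zero. -/
theorem exists_code {X : Type} [Inhabited X] (Y : Finset X) (k w : ℕ) (hY : Y.card ≤ 2 ^ (k * w)) :
    ∃ (e : X → ℕ → (Fin k → Bool)) (d : (ℕ → (Fin k → Bool)) → X),
      (∀ x c, w ≤ c → e x c = fun _ => false) ∧ ∀ x ∈ Y, d (e x) = x := by
  classical
  have hcard : Fintype.card Y ≤ Fintype.card (Fin w → Fin k → Bool) := by
    simpa [← pow_mul] using hY
  obtain ⟨f⟩ := Function.Embedding.nonempty_of_card_le hcard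
  let e : X → ℕ → (Fin k → Bool) := fun x c =>
    if h : x ∈ Y ∧ c < w then f ⟨x, h.1⟩ ⟨c, h.2⟩ else fun _ => false
  have he : Set.InjOn e Y := by
    intro x hx y hy hxy
    have : f ⟨x, hx⟩ = f ⟨y, hy⟩ := by
      funext c
      have := congrFun hxy c
      simpa [e, Finset.mem_coe.mp hx, Finset.mem_coe.mp hy, c.2] using this
    simpa using f.injective this
  refine ⟨e, Function.invFunOn e Y, fun x c hc => ?_, fun x hx => ?_⟩
  · simp [e, not_lt.mpr hc]
  · exact he.leftInvOn_invFunOn hx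

theorem card_filter_card_le {β : Type} [DecidableEq β] (S : Finset β) (t : ℕ) :
    (S.powerset.filter fun P => P.card ≤ t).card ≤ (S.card + 1) ^ t := by
  induction t with
  | zero =>
    rw [pow_zero, Finset.card_le_one]
    simp +contextual
  | succ t ih =>
    -- A set of size at most `t + 1` is a set of size at most `t` with at most one more element.
    have hsub : (S.powerset.filter fun P => P.card ≤ t + 1) ⊆
        ((S.powerset.filter fun P => P.card ≤ t) ×ˢ S.insertNone).image
          fun x => x.2.elim x.1 (fun e => insert e x.1) := by
      intro P hP
      obtain ⟨hPS, hPt⟩ := Finset.mem_filter.mp hP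
      rw [Finset.mem_powerset] at hPS
      rw [Finset.mem_image]
      rcases P.eq_empty_or_nonempty with rfl | ⟨e, he⟩
      · exact ⟨(∅, none), by simp, rfl⟩
      · refine ⟨(P.erase e, some e), ?_, by simp [Finset.insert_erase he]⟩
        simp only [Finset.mem_product, Finset.mem_filter, Finset.mem_powerset,
          Finset.some_mem_insertNone]
        refine ⟨⟨(Finset.erase_subset _ _).trans hPS, ?_⟩, hPS he⟩
        rw [Finset.card_erase_of_mem he]; omega
    refine (Finset.card_le_card hsub).trans (Finset.card_image_le.trans ?_)
    rw [Finset.card_product, Finset.card_insertNone, pow_succ]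
    gcongr

/-! ### Cuts as sets that meet all walks -/

/-- A kind of cuts, described by names in `α` of the elements that can be removed.
`opts a b m` lists the ways to go from the node with identifier `a` to its neighbour with
identifier `b` when `m > 0` edges join them: each way is the set of the elements that it uses.
`adm a F` says that the node with identifier `a` is still there after the removal of `F`. -/
structure CutKind (α : Type) where
  opts : ℕ → ℕ → ℕ → Finset (Finset α)
  opts_comm : ∀ a b m, opts a b m = opts b a m
  opts_nonempty : ∀ a b m, 0 < m → (opts a b m).Nonempty
  card_le_two : ∀ a b m, ∀ p ∈ opts a b m, p.card ≤ 2
  adm : ℕ → Finset α → Prop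
  adm_mono : ∀ {a : ℕ} {F F' : Finset α}, F' ⊆ F → adm a F → adm a F'

namespace CutKind

variable {α : Type} (K : CutKind α) {V : Type} (G : Multigraph V) (ids : V ↪ ℕ)

/-- The graph that is left after the removal of `F`. Removed vertices become isolated. -/
def residual (F : Finset α) : SimpleGraph V where
  Adj v u := G.graph.Adj v u ∧ ∃ p ∈ K.opts (ids v) (ids u) (G.mult s(v, u)), Disjoint p F
  symm := ⟨fun v u h => by rwa [G.graph.adj_comm, K.opts_comm, Sym2.eq_swap] at h⟩
  loopless := ⟨fun v h => G.graph.irrefl h.1⟩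

/-- After the removal of `F`, two remaining nodes are not connected with each other. -/
def Separates (F : Finset α) : Prop :=
  ∃ s v, K.adm (ids s) F ∧ K.adm (ids v) F ∧ ¬ (K.residual G ids F).Reachable s v

/-- A separator of minimum cardinality. -/
def IsMinSeparator (F : Finset α) : Prop :=
  K.Separates G ids F ∧ ∀ F', K.Separates G ids F' → F.card ≤ F'.card

variable {K G ids}

theorem residual_empty : K.residual G ids ∅ = G.graph := by
  ext v u
  refine ⟨fun h => h.1, fun h => ⟨h, ?_⟩⟩
  obtain ⟨p, hp⟩ := K.opts_nonempty (ids v) (ids u) _ (Multigraph.graph_adj.mp h)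
  exact ⟨p, hp, Finset.disjoint_empty_right _⟩

end CutKind

/-! ### Families of walks -/

section families

variable {α : Type} [DecidableEq α] (K : CutKind α) (Λ t : ℕ)

/-- The walks that a node knows after it has heard the walks that its neighbours know. -/
def gather (I : NodeInfo) (own : Finset (ℕ × Finset α))
    (nbr : ℕ → Option (Finset (ℕ × Finset α))) : Set (ℕ × Finset α) :=
  {x | x ∈ own ∨ ∃ j f m P p, nbr j = some f ∧ (m, P) ∈ f ∧ p ∈ K.opts I.1 j (I.2 j) ∧
    x = (m, p ∪ P)}

variable {V : Type} (G : Multigraph V) (ids : V ↪ ℕ)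

/-- The families of walks that the nodes know after `i` rounds. A walk from `s` to `v` is stored
at `v` as the pair of the identifier of `s` and the set of the elements that the walk uses. -/
noncomputable def walkFamily : ℕ → V → Finset (ℕ × Finset α)
  | 0 => fun v => {(ids v, ∅)}
  | i + 1 => fun v => compress t Λ
      (gather K (nodeInfo G ids v) (walkFamily i v) (heard G ids (walkFamily i) v))

variable {K Λ t G ids}

theorem mem_gather_heard {f : V → Finset (ℕ × Finset α)} {v : V} {x : ℕ × Finset α} :
    x ∈ gather K (nodeInfo G ids v) (f v) (heard G ids f v) ↔
      x ∈ f v ∨ ∃ u m P p, G.graph.Adj v u ∧ (m, P) ∈ f u ∧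
        p ∈ K.opts (ids v) (ids u) (G.mult s(v, u)) ∧ x = (m, p ∪ P) := by
  refine or_congr_right ⟨?_, ?_⟩
  · rintro ⟨j, g, m, P, p, hj, hP, hp, rfl⟩
    obtain ⟨u, rfl, ha, rfl⟩ := heard_eq_some.mp hj
    simp only [nodeInfo, links_apply] at hp
    exact ⟨u, m, P, p, ha, hP, hp, rfl⟩
  · rintro ⟨u, m, P, p, ha, hP, hp, rfl⟩
    refine ⟨ids u, f u, m, P, p, heard_eq_some.mpr ⟨u, rfl, ha, rfl⟩, hP, ?_, rfl⟩
    simpa only [nodeInfo, links_apply] using hp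

/-- A known pair comes from a walk, which survives the removal of every set that its elements
avoid. -/
theorem walkFamily_sound {i : ℕ} {v : V} {x : ℕ × Finset α}
    (hx : x ∈ walkFamily K Λ t G ids i v) :
    x.2.card ≤ 2 * i ∧ ∃ s, ids s = x.1 ∧ (∃ p : G.graph.Walk v s, p.length ≤ i) ∧
      ∀ F, Disjoint x.2 F → (K.residual G ids F).Reachable s v := by
  induction i generalizing v x with
  | zero =>
    obtain rfl := Finset.mem_singleton.mp hx
    exact ⟨by simp, v, rfl, ⟨.nil, le_rfl⟩, fun F _ => .rfl⟩
  | succ i ih =>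
    rcases mem_gather_heard.mp (mem_of_mem_compress hx) with hx | ⟨u, m, P, p, ha, hP, hp, rfl⟩
    · obtain ⟨hc, s, hs, ⟨q, hq⟩, hF⟩ := ih hx
      exact ⟨by omega, s, hs, ⟨q, by omega⟩, hF⟩
    · obtain ⟨hc, s, hs, ⟨q, hq⟩, hF⟩ := ih hP
      refine ⟨?_, s, hs, ⟨.cons ha q, by simpa using hq⟩, fun F hd => ?_⟩
      · have h1 := Finset.card_union_le p P
        have h2 := K.card_le_two _ _ _ p hp
        simp only at hc ⊢
        omega
      · rw [Finset.disjoint_union_left] at hd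
        have hadj : (K.residual G ids F).Adj v u := ⟨ha, p, hp, hd.1⟩
        exact (hF F hd.2).trans hadj.symm.reachable

theorem walkFamily_subset {N : ℕ} {U : Finset α} (hids : ∀ v, ids v < N)
    (hU : ∀ a < N, ∀ b < N, ∀ m, ∀ p ∈ K.opts a b m, p ⊆ U) {i : ℕ} {v : V} {x : ℕ × Finset α}
    (hx : x ∈ walkFamily K Λ t G ids i v) : x.2 ⊆ U := by
  induction i generalizing v x with
  | zero =>
    obtain rfl := Finset.mem_singleton.mp hx
    exact Finset.empty_subset _
  | succ i ih =>
    rcases mem_gather_heard.mp (mem_of_mem_compress hx) with hx | ⟨u, m, P, p, -, hP, hp, rfl⟩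
    · exact ih hx
    · exact Finset.union_subset (hU _ (hids v) _ (hids u) _ p hp) (ih hP)

theorem card_walkFamily_le {i : ℕ} {v : V} :
    (walkFamily K Λ t G ids i v).card ≤ (Λ + 1) * (t + 1) ^ Λ := by
  cases i with
  | zero =>
    rw [walkFamily, Finset.card_singleton]
    exact Nat.succ_le_of_lt (by positivity)
  | succ i => exact card_compress_le

theorem card_le_of_mem_gather {i : ℕ} (hi : 2 * (i + 1) ≤ t) {v : V} {x : ℕ × Finset α}
    (hx : x ∈ gather K (nodeInfo G ids v) (walkFamily K Λ t G ids i v)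
      (heard G ids (walkFamily K Λ t G ids i) v)) : x.2.card ≤ t := by
  rcases mem_gather_heard.mp hx with hx | ⟨u, m, P, p, -, hP, hp, rfl⟩
  · have := (walkFamily_sound hx).1
    omega
  · have h1 := Finset.card_union_le p P
    have h2 := K.card_le_two _ _ _ p hp
    have h3 := (walkFamily_sound hP).1
    simp only at h3 ⊢
    omega

/-- Every walk from one of the `Λ + 1` nodes with the smallest identifiers is represented with
respect to the removal of at most `Λ` elements. -/
theorem walkFamily_complete {s : V} (hs : {u | ids u < ids s}.ncard ≤ Λ) {F : Finset α}
    (hF : F.card ≤ Λ) {i : ℕ} (hi : 2 * i ≤ t) {v : V} (p : (K.residual G ids F).Walk v s)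
    (hp : p.length ≤ i) : ∃ P, (ids s, P) ∈ walkFamily K Λ t G ids i v ∧ Disjoint P F := by
  induction i generalizing v with
  | zero =>
    cases p with
    | nil => exact ⟨∅, by simp [walkFamily], Finset.disjoint_empty_left _⟩
    | cons h p => simp at hp
  | succ i ih =>
    suffices h : ∃ P, (ids s, P) ∈ gather K (nodeInfo G ids v) (walkFamily K Λ t G ids i v)
        (heard G ids (walkFamily K Λ t G ids i) v) ∧ Disjoint P F by
      obtain ⟨P, hP, hd⟩ := h
      refine exists_mem_compress (fun x hx => card_le_of_mem_gather hi hx) hP ?_ hF hd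
      have hfin : {u | ids u < ids s}.Finite :=
        Set.Finite.of_finite_image ((Set.finite_Iio (ids s)).subset (by
          rintro _ ⟨u, hu, rfl⟩
          exact hu)) ids.injective.injOn
      refine (Set.ncard_le_ncard (t := ids '' {u | ids u < ids s}) ?_ (hfin.image _)).trans
        ((Set.ncard_image_le hfin).trans hs)
      rintro m ⟨⟨Q, hQ⟩, hm⟩
      rcases mem_gather_heard.mp hQ with hQ | ⟨u, m', P', p', -, hP', -, heq⟩
      · obtain ⟨-, s', hs', -⟩ := walkFamily_sound hQ
        simp only at hs'
        subst hs'
        exact ⟨s', hm, rfl⟩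
      · obtain ⟨-, s', hs', -⟩ := walkFamily_sound hP'
        obtain ⟨rfl, -⟩ := Prod.mk.inj heq
        simp only at hs'
        subst hs'
        exact ⟨s', hm, rfl⟩
    cases p with
    | nil =>
      obtain ⟨P, hP, hd⟩ := ih (by omega) .nil (by simp)
      exact ⟨P, mem_gather_heard.mpr (.inl hP), hd⟩
    | @cons _ u _ h p =>
      obtain ⟨P, hP, hd⟩ := ih (by omega) p (by simpa using hp)
      obtain ⟨ha, q, hq, hqF⟩ := h
      exact ⟨q ∪ P, mem_gather_heard.mpr (.inr ⟨u, _, P, q, ha, hP, hq, rfl⟩),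
        Finset.disjoint_union_left.mpr ⟨hqF, hd⟩⟩

/-- The smallest source in a family of walks. -/
noncomputable def lead (f : Finset (ℕ × Finset α)) : ℕ :=
  sInf (sources (f : Set (ℕ × Finset α)))

theorem walkFamily_nonempty {i : ℕ} (hi : 2 * i ≤ t) (v : V) :
    (walkFamily K Λ t G ids i v).Nonempty := by
  induction i with
  | zero => exact Finset.singleton_nonempty _
  | succ i ih =>
    obtain ⟨x, hx⟩ := ih (by omega)
    set A := gather K (nodeInfo G ids v) (walkFamily K Λ t G ids i v)
      (heard G ids (walkFamily K Λ t G ids i) v) with hA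
    have hne : (sources A).Nonempty := ⟨x.1, x.2, mem_gather_heard.mpr (.inl hx)⟩
    obtain ⟨P, hP⟩ := Nat.sInf_mem hne
    have hrank : {m' ∈ sources A | m' < sInf (sources A)} = ∅ :=
      Set.eq_empty_of_forall_notMem fun m hm => absurd hm.2 (not_lt.mpr (Nat.sInf_le hm.1))
    obtain ⟨Q, hQ, -⟩ := exists_mem_compress (k := Λ) (F := ∅)
      (fun x hx => card_le_of_mem_gather hi hx) hP (by rw [hrank]; simp) (by simp)
      (Finset.disjoint_empty_right _)
    exact ⟨_, hQ⟩

theorem exists_lead_eq {i : ℕ} (hi : 2 * i ≤ t) (v : V) :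
    ∃ s, ids s = lead (walkFamily K Λ t G ids i v) ∧ ∃ p : G.graph.Walk v s, p.length ≤ i := by
  obtain ⟨x, hx⟩ := walkFamily_nonempty (K := K) (Λ := Λ) (G := G) (ids := ids) hi v
  obtain ⟨P, hP⟩ := Nat.sInf_mem (s := sources
    (walkFamily K Λ t G ids i v : Set (ℕ × Finset α))) ⟨x.1, x.2, hx⟩
  obtain ⟨-, s, hs, hp, -⟩ := walkFamily_sound (Finset.mem_coe.mp hP)
  exact ⟨s, hs, hp⟩

/-- A node within distance `i` of the node with the smallest identifier knows it after `i` rounds. -/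
theorem lead_eq {i : ℕ} (hi : 2 * i ≤ t) {v s : V} (hs : ∀ u, ids s ≤ ids u)
    (p : G.graph.Walk v s) (hp : p.length ≤ i) :
    lead (walkFamily K Λ t G ids i v) = ids s := by
  have hrank : {u | ids u < ids s} = ∅ :=
    Set.eq_empty_of_forall_notMem fun u hu => absurd hu (not_lt.mpr (hs u))
  obtain ⟨P, hP, -⟩ := walkFamily_complete (K := K) (Λ := Λ) (F := ∅) (by rw [hrank]; simp)
    (by simp) hi (p.mapLe CutKind.residual_empty.ge) (by simpa using hp)
  obtain ⟨s', hs', -⟩ := exists_lead_eq (K := K) (Λ := Λ) (G := G) (ids := ids) hi v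
  exact le_antisymm (Nat.sInf_le ⟨P, hP⟩) (hs' ▸ hs s')

end families

/-! ### What the known walks tell -/

section candidates

variable {α : Type} [DecidableEq α] (K : CutKind α) (Λ : ℕ)

/-- The smallest source that is still there after the removal of `F`. -/
noncomputable def pivot (f : Finset (ℕ × Finset α)) (F : Finset α) : ℕ :=
  sInf {m | m ∈ sources (f : Set (ℕ × Finset α)) ∧ K.adm m F}

open Classical in
/-- The sets of at most `Λ` elements of known walks that separate the node `a` from the smallest
remaining source, as far as the known walks tell. -/
noncomputable def candidates (a : ℕ) (f : Finset (ℕ × Finset α)) : Finset (Finset α) :=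
  (f.biUnion Prod.snd).powerset.filter fun F =>
    F.card ≤ Λ ∧ K.adm a F ∧ ∀ P, (pivot K f F, P) ∈ f → ¬ Disjoint P F

variable {K Λ} {V : Type} {G : Multigraph V} {ids : V ↪ ℕ}

theorem pivot_eq {t i : ℕ} {F : Finset α} {v s : V} (hsF : K.adm (ids s) F)
    (hmin : ∀ u, K.adm (ids u) F → ids s ≤ ids u)
    (hs : ids s ∈ sources (walkFamily K Λ t G ids i v : Set (ℕ × Finset α))) :
    pivot K (walkFamily K Λ t G ids i v) F = ids s := by
  refine le_antisymm (Nat.sInf_le ⟨hs, hsF⟩) ?_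
  obtain ⟨⟨P, hP⟩, hadm⟩ := Nat.sInf_mem (s := {m | m ∈
    sources (walkFamily K Λ t G ids i v : Set (ℕ × Finset α)) ∧ K.adm m F}) ⟨_, hs, hsF⟩
  obtain ⟨-, u, hu, -⟩ := walkFamily_sound (Finset.mem_coe.mp hP)
  simp only at hu
  rw [← hu] at hadm
  exact (hmin u hadm).trans hu.le

/-- The known walks tell whether a set of at most `Λ` elements separates `v` from a node with one of
the smallest identifiers. -/
theorem forall_not_disjoint_iff {l : ℕ} {F : Finset α} (hF : F.card ≤ Λ)
    (hshort : ∀ s v, (K.residual G ids F).Reachable s v →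
      ∃ p : (K.residual G ids F).Walk v s, p.length ≤ l)
    {s v : V} (hs : {u | ids u < ids s}.ncard ≤ Λ) :
    (∀ P, (ids s, P) ∈ walkFamily K Λ (2 * l) G ids l v → ¬ Disjoint P F) ↔
      ¬ (K.residual G ids F).Reachable s v := by
  constructor
  · intro h hr
    obtain ⟨p, hp⟩ := hshort s v hr
    obtain ⟨P, hP, hd⟩ := walkFamily_complete hs hF le_rfl p hp
    exact h P hP hd
  · intro h P hP hd
    obtain ⟨-, s', hs', -, hr⟩ := walkFamily_sound hP
    obtain rfl := ids.injective hs'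
    exact h (hr F hd)

/-- Among the nodes that remain after the removal of `F`, the one with the smallest identifier has at
most `Λ` predecessors, so it is a source whose walks every node knows. -/
theorem exists_pivot [Finite V] {l : ℕ} (hG : G.graph.Connected)
    (hshort : ∀ F : Finset α, F.card ≤ Λ → ∀ s v, (K.residual G ids F).Reachable s v →
      ∃ p : (K.residual G ids F).Walk v s, p.length ≤ l)
    (hadm : ∀ F : Finset α, F.card ≤ Λ → {u | ¬ K.adm (ids u) F}.ncard ≤ Λ)
    {F : Finset α} (hF : F.card ≤ Λ) {x : V} (hx : K.adm (ids x) F) :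
    ∃ s, K.adm (ids s) F ∧ {u | ids u < ids s}.ncard ≤ Λ ∧
      ∀ v, pivot K (walkFamily K Λ (2 * l) G ids l v) F = ids s := by
  obtain ⟨s, hs, hmin⟩ := Set.exists_min_image {u | K.adm (ids u) F} ids (Set.toFinite _) ⟨x, hx⟩
  have hrank : {u | ids u < ids s}.ncard ≤ Λ :=
    (Set.ncard_le_ncard (t := {u | ¬ K.adm (ids u) F})
      (fun u hu hau => absurd (hmin u hau) (not_le.mpr hu)) (Set.toFinite _)).trans (hadm F hF)
  refine ⟨s, hs, hrank, fun v => pivot_eq hs hmin ?_⟩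
  obtain ⟨p, hp⟩ := hshort ∅ (by simp) s v (by
    rw [CutKind.residual_empty]
    exact hG.preconnected s v)
  obtain ⟨P, hP, -⟩ := walkFamily_complete hrank (by simp) le_rfl p hp
  exact ⟨P, hP⟩

theorem separates_of_mem_candidates [Finite V] {l : ℕ} (hG : G.graph.Connected)
    (hshort : ∀ F : Finset α, F.card ≤ Λ → ∀ s v, (K.residual G ids F).Reachable s v →
      ∃ p : (K.residual G ids F).Walk v s, p.length ≤ l)
    (hadm : ∀ F : Finset α, F.card ≤ Λ → {u | ¬ K.adm (ids u) F}.ncard ≤ Λ)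
    {v : V} {F : Finset α}
    (h : F ∈ candidates K Λ (ids v) (walkFamily K Λ (2 * l) G ids l v)) :
    F.card ≤ Λ ∧ K.Separates G ids F := by
  classical
  obtain ⟨-, hF, hv, hd⟩ := Finset.mem_filter.mp h
  obtain ⟨s, hs, hrank, hpiv⟩ := exists_pivot hG hshort hadm hF hv
  rw [hpiv v] at hd
  exact ⟨hF, s, v, hs, hv, (forall_not_disjoint_iff hF (hshort F hF) hrank).mp hd⟩

/-- A minimum separator `F` consists of elements of known walks: the known walks cannot tell
`F` from its intersection with the set of these elements, which would be a smaller separator. -/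
theorem exists_mem_candidates [Finite V] {l : ℕ} (hG : G.graph.Connected)
    (hshort : ∀ F : Finset α, F.card ≤ Λ → ∀ s v, (K.residual G ids F).Reachable s v →
      ∃ p : (K.residual G ids F).Walk v s, p.length ≤ l)
    (hadm : ∀ F : Finset α, F.card ≤ Λ → {u | ¬ K.adm (ids u) F}.ncard ≤ Λ)
    {F : Finset α} (hF : F.card ≤ Λ)
    (hmin : K.IsMinSeparator G ids F) :
    ∃ v, F ∈ candidates K Λ (ids v) (walkFamily K Λ (2 * l) G ids l v) := by
  classical
  obtain ⟨⟨x, y, hx, hy, hxy⟩, hmin⟩ := hmin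
  obtain ⟨s, hs, hrank, hpiv⟩ := exists_pivot hG hshort hadm hF hx
  obtain ⟨v, hv, hsv⟩ : ∃ v, K.adm (ids v) F ∧ ¬ (K.residual G ids F).Reachable s v := by
    by_contra! h
    exact hxy ((h x hx).symm.trans (h y hy))
  have hhit := (forall_not_disjoint_iff hF (hshort F hF) hrank).mpr hsv
  set W := (walkFamily K Λ (2 * l) G ids l v).biUnion Prod.snd with hW
  have hF0 : (F ∩ W).card ≤ Λ := (Finset.card_le_card Finset.inter_subset_left).trans hF
  have hsep : K.Separates G ids (F ∩ W) := by
    refine ⟨s, v, K.adm_mono Finset.inter_subset_left hs,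
      K.adm_mono Finset.inter_subset_left hv,
      (forall_not_disjoint_iff hF0 (hshort _ hF0) hrank).mp fun P hP hd => hhit P hP ?_⟩
    rw [Finset.disjoint_left] at hd ⊢
    exact fun e heP heF => hd heP
      (Finset.mem_inter.mpr ⟨heF, Finset.mem_biUnion.mpr ⟨_, hP, heP⟩⟩)
  have hsub : F ⊆ W := Finset.inter_eq_left.mp
    (Finset.eq_of_subset_of_card_le Finset.inter_subset_left (hmin _ hsep))
  refine ⟨v, Finset.mem_filter.mpr ⟨Finset.mem_powerset.mpr hsub, hF, hv, ?_⟩⟩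
  rw [hpiv v]
  exact hhit

end candidates

/-! ### The minimum cut protocol -/

/-- The least element of `S`, and `⊤` if `S` is empty. -/
noncomputable def leastOf {X : Type} [LinearOrder X] [OrderTop X] [WellFoundedLT X] (S : Set X) :
    X :=
  wellFounded_lt.min (insert ⊤ S) ⟨⊤, Set.mem_insert _ _⟩

section leastOf

variable {X : Type} [LinearOrder X] [OrderTop X] [WellFoundedLT X] {S : Set X}

theorem leastOf_le {x : X} (hx : x ∈ S) : leastOf S ≤ x :=
  not_lt.mp (wellFounded_lt.not_lt_min _ (Set.mem_insert_of_mem _ hx))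

theorem leastOf_mem : leastOf S = ⊤ ∨ leastOf S ∈ S :=
  wellFounded_lt.min_mem (insert ⊤ S) _

end leastOf

/-- The lexicographic order on pairs of naturals, by which candidate cuts are compared. -/
abbrev CutKey : Type :=
  WithTop (ℕ ×ₗ ℕ)

/-- An injective key that compares sets by size first. -/
noncomputable def cutKey {α : Type} [Countable α] (F : Finset α) : CutKey :=
  ((toLex (F.card, (Countable.exists_injective_nat (Finset α)).choose F) : ℕ ×ₗ ℕ) : CutKey)

theorem cutKey_injective {α : Type} [Countable α] :
    Function.Injective (cutKey : Finset α → CutKey) := by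
  intro F F' h
  have h' := (Prod.mk.inj (toLex.injective (WithTop.coe_injective h))).2
  exact (Countable.exists_injective_nat (Finset α)).choose_spec h'

theorem card_le_of_cutKey_le {α : Type} [Countable α] {F F' : Finset α}
    (h : cutKey F ≤ cutKey F') : F.card ≤ F'.card := by
  have h' := WithTop.coe_le_coe.mp h
  rw [Prod.Lex.toLex_le_toLex] at h'
  rcases h' with h' | h'
  · exact h'.le
  · exact h'.1.le

theorem cutKey_ne_top {α : Type} [Countable α] (F : Finset α) : cutKey F ≠ ⊤ :=
  WithTop.coe_ne_top

/-- The state of a node: the walks it knows, whether it knows that the phase fails, and the key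
of the best cut it knows of. -/
structure CutState (α : Type) where
  family : Finset (ℕ × Finset α)
  bad : Prop
  best : CutKey

section protocol

variable {α : Type} [DecidableEq α] [Countable α] (K : CutKind α) (Λ : ℕ)

/-- Phase `R` works with the guess that the diameter is at most `R`, and `overload R I` tells a node
with initial knowledge `I` that the guess `R` is too small for another reason. In the rounds before
round `L R` the nodes learn walks. In round `R` neighbours compare their smallest sources;
the flag `bad` floods the graph if somewhere they differ. After round `L R` the least candidate
floods the graph. -/
@[reducible]
noncomputable def cutProtocol (L : ℕ → ℕ) (overload : ℕ → NodeInfo → Prop) :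
    PhasedProtocol (CutOutput α) where
  State := CutState α
  start R I := ⟨{(I.1, ∅)}, overload R I, ⊤⟩
  step R i I x m :=
    { family := if i < L R then
        compress (2 * L R) Λ (gather K I x.family fun j => (m j).map CutState.family)
        else x.family
      bad := x.bad ∨ (∃ j y, m j = some y ∧ y.bad) ∨
        (i = R ∧ ∃ j y, m j = some y ∧ lead y.family ≠ lead x.family)
      best := if i < L R then ⊤ else leastOf ({x.best} ∪
        cutKey '' (candidates K Λ I.1 x.family : Set (Finset α)) ∪
        {b | ∃ j y, m j = some y ∧ b = y.best}) }
  rounds R := L R + 2 * R + 1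
  result _ I x := open Classical in if x.bad then none else
    some ⟨Function.invFun cutKey x.best,
      (candidates K Λ I.1 x.family).filter fun F =>
        F.card = (Function.invFun cutKey x.best : Finset α).card⟩

end protocol

section analysis

variable {α : Type} [DecidableEq α] [Countable α] {K : CutKind α} {Λ : ℕ} {L : ℕ → ℕ}
  {overload : ℕ → NodeInfo → Prop} {V : Type} {G : Multigraph V} {ids : V ↪ ℕ} {R : ℕ}

theorem heard_map {X Y : Type} (f : X → Y) (x : V → X) (v : V) :
    (fun j => (heard G ids x v j).map f) = heard G ids (fun u => f (x u)) v := by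
  funext j
  ext y
  simp only [Option.map_eq_some_iff, heard_eq_some]
  constructor
  · rintro ⟨_, ⟨u, rfl, ha, rfl⟩, rfl⟩
    exact ⟨u, rfl, ha, rfl⟩
  · rintro ⟨u, rfl, ha, rfl⟩
    exact ⟨_, ⟨u, rfl, ha, rfl⟩, rfl⟩

theorem config_family (i : ℕ) (v : V) :
    ((cutProtocol K Λ L overload).config G ids R i v).family =
      walkFamily K Λ (2 * L R) G ids (min i (L R)) v := by
  induction i generalizing v with
  | zero => rw [Nat.zero_min]; rfl
  | succ i ih =>
    have hsucc : ((cutProtocol K Λ L overload).config G ids R (i + 1) v).family =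
        if i < L R then compress (2 * L R) Λ (gather K (nodeInfo G ids v)
          ((cutProtocol K Λ L overload).config G ids R i v).family
          (heard G ids (fun u => ((cutProtocol K Λ L overload).config G ids R i u).family) v))
        else ((cutProtocol K Λ L overload).config G ids R i v).family := by
      rw [← heard_map CutState.family]
      rfl
    rw [hsucc]
    simp only [ih]
    split_ifs with h
    · rw [min_eq_left h.le, min_eq_left (Nat.succ_le_of_lt h)]
      rfl
    · rw [min_eq_right (not_lt.mp h), min_eq_right (by omega)]

/-! ### Whether a phase succeeds -/

variable (K Λ L G ids R) in
/-- In round `R` of phase `R` a neighbour of `v` has another smallest source than `v`. -/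
def Mismatch (v : V) : Prop :=
  ∃ u, G.graph.Adj v u ∧ lead (walkFamily K Λ (2 * L R) G ids R u) ≠
    lead (walkFamily K Λ (2 * L R) G ids R v)

theorem config_bad_succ (hRL : R ≤ L R) (i : ℕ) (v : V) :
    ((cutProtocol K Λ L overload).config G ids R (i + 1) v).bad ↔
      ((cutProtocol K Λ L overload).config G ids R i v).bad ∨
      (∃ u, G.graph.Adj v u ∧ ((cutProtocol K Λ L overload).config G ids R i u).bad) ∨
      (i = R ∧ Mismatch K Λ L G ids R v) := by
  change (_ ∨ (∃ j y, _) ∨ (_ ∧ ∃ j y, _)) ↔ _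
  refine or_congr_right (or_congr ?_ (and_congr_right ?_))
  · constructor
    · rintro ⟨j, y, hy, hb⟩
      obtain ⟨u, rfl, ha, rfl⟩ := heard_eq_some.mp hy
      exact ⟨u, ha, hb⟩
    · rintro ⟨u, ha, hb⟩
      exact ⟨ids u, _, heard_eq_some.mpr ⟨u, rfl, ha, rfl⟩, hb⟩
  · rintro rfl
    constructor
    · rintro ⟨j, y, hy, hb⟩
      obtain ⟨u, rfl, ha, rfl⟩ := heard_eq_some.mp hy
      rw [config_family, config_family, min_eq_left hRL] at hb
      exact ⟨u, ha, hb⟩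
    · rintro ⟨u, ha, hb⟩
      refine ⟨ids u, _, heard_eq_some.mpr ⟨u, rfl, ha, rfl⟩, ?_⟩
      rwa [config_family, config_family, min_eq_left hRL]

theorem exists_of_config_bad (hRL : R ≤ L R) {i : ℕ} {v : V}
    (h : ((cutProtocol K Λ L overload).config G ids R i v).bad) :
    ∃ z, overload R (nodeInfo G ids z) ∨ Mismatch K Λ L G ids R z := by
  induction i generalizing v with
  | zero => exact ⟨v, .inl h⟩
  | succ i ih =>
    rcases (config_bad_succ hRL i v).mp h with h | ⟨u, -, h⟩ | ⟨-, h⟩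
    · exact ih h
    · exact ih h
    · exact ⟨v, .inr h⟩

theorem config_bad_of_walk (hRL : R ≤ L R) {v z : V} (p : G.graph.Walk v z) {i j : ℕ}
    (hij : i + p.length ≤ j) (h : ((cutProtocol K Λ L overload).config G ids R i z).bad) :
    ((cutProtocol K Λ L overload).config G ids R j v).bad := by
  induction j generalizing v i with
  | zero =>
    cases p with
    | nil => obtain rfl : i = 0 := by simpa using hij
             exact h
    | cons _ _ => simp at hij
  | succ j ih =>
    rw [config_bad_succ hRL]
    rcases hij.lt_or_eq with hlt | heq
    · exact .inl (ih p (by omega) h)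
    cases p with
    | nil =>
      obtain rfl : i = j + 1 := by simpa using heq
      exact (config_bad_succ hRL _ _).mp h
    | @cons _ u _ ha p =>
      rw [SimpleGraph.Walk.length_cons] at hij
      exact .inr (.inl ⟨u, ha, ih p (by omega) h⟩)

theorem config_bad_of_witness (hRL : R ≤ L R) {z : V}
    (hz : overload R (nodeInfo G ids z) ∨ Mismatch K Λ L G ids R z) :
    ((cutProtocol K Λ L overload).config G ids R (R + 1) z).bad := by
  rcases hz with h | h
  · exact config_bad_of_walk (i := 0) hRL .nil (by simp) h
  · exact (config_bad_succ hRL _ _).mpr (.inr (.inr ⟨rfl, h⟩))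

/-- At the end of a phase, either all nodes know that it fails, or no node says so; in the
latter case some ball of radius `R` is the whole graph. -/
theorem phase_dichotomy (hG : G.graph.Connected) (hRL : R ≤ L R) :
    (∀ v, ((cutProtocol K Λ L overload).config G ids R (L R + 2 * R + 1) v).bad) ∨
    (∀ v, ¬ ((cutProtocol K Λ L overload).config G ids R (L R + 2 * R + 1) v).bad) ∧
      (∀ v, ¬ overload R (nodeInfo G ids v)) ∧
      ∃ x, ∀ v, ∃ p : G.graph.Walk v x, p.length ≤ R := by
  set ld : V → ℕ := fun v => lead (walkFamily K Λ (2 * L R) G ids R v) with hld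
  have hspec : ∀ v, ∃ s, ids s = ld v ∧ ∃ p : G.graph.Walk v s, p.length ≤ R :=
    fun v => exists_lead_eq (by omega) v
  -- Two nodes with the same smallest source are close to each other.
  have hclose : ∀ u v, ld u = ld v → ∃ p : G.graph.Walk u v, p.length ≤ 2 * R := by
    intro u v huv
    obtain ⟨s, hs, p, hp⟩ := hspec u
    obtain ⟨s', hs', q, hq⟩ := hspec v
    obtain rfl := ids.injective (hs.trans (huv.trans hs'.symm))
    refine ⟨p.append q.reverse, ?_⟩
    rw [SimpleGraph.Walk.length_append, SimpleGraph.Walk.length_reverse]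
    omega
  by_cases hz : ∃ z, overload R (nodeInfo G ids z) ∨ Mismatch K Λ L G ids R z
  · refine .inl fun v => ?_
    suffices h : ∃ z, (overload R (nodeInfo G ids z) ∨ Mismatch K Λ L G ids R z) ∧
        ld v = ld z by
      obtain ⟨z, hz, hvz⟩ := h
      obtain ⟨p, hp⟩ := hclose v z hvz
      exact config_bad_of_walk hRL p (by omega) (config_bad_of_witness hRL hz)
    by_cases hconst : ∀ u, ld v = ld u
    · obtain ⟨z, hz⟩ := hz
      exact ⟨z, hz, hconst z⟩
    · push Not at hconst
      obtain ⟨u, hu⟩ := hconst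
      obtain ⟨p⟩ := hG.preconnected v u
      obtain ⟨d, -, h1, h2⟩ := p.exists_boundary_dart {x | ld v = ld x} rfl hu
      exact ⟨d.fst, .inr ⟨d.snd, d.adj, fun h => h2 (Eq.trans h1 h.symm)⟩, h1⟩
  · refine .inr ⟨fun v h => hz (exists_of_config_bad hRL h), fun v h => hz ⟨v, .inl h⟩, ?_⟩
    have hconst : ∀ u v, ld u = ld v := by
      intro u v
      by_contra huv
      obtain ⟨p⟩ := hG.preconnected u v
      obtain ⟨d, -, h1, h2⟩ := p.exists_boundary_dart {x | ld u = ld x} rfl huv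
      exact hz ⟨d.fst, .inr ⟨d.snd, d.adj, fun h => h2 (Eq.trans h1 h.symm)⟩⟩
    obtain ⟨v₀⟩ := hG.nonempty
    obtain ⟨x, hx, -⟩ := hspec v₀
    refine ⟨x, fun v => ?_⟩
    obtain ⟨s, hs, hp⟩ := hspec v
    obtain rfl := ids.injective (hs.trans ((hconst v v₀).trans hx.symm))
    exact hp

/-- A phase with a sufficiently large guess succeeds. -/
theorem phase_succeeds [Nonempty V] (hRL : R ≤ L R)
    (hdiam : ∀ u v : V, ∃ p : G.graph.Walk u v, p.length ≤ R)
    (hload : ∀ v, ¬ overload R (nodeInfo G ids v)) (i : ℕ) (v : V) :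
    ¬ ((cutProtocol K Λ L overload).config G ids R i v).bad := by
  intro h
  obtain ⟨z, hz⟩ := exists_of_config_bad hRL h
  obtain ⟨s, hs⟩ : ∃ s, ∀ u, ids s ≤ ids u :=
    ⟨Function.argmin ids, fun u => Function.argmin_le ids u⟩
  rcases hz with hz | ⟨u, -, hu⟩
  · exact hload z hz
  · obtain ⟨p, hp⟩ := hdiam u s
    obtain ⟨q, hq⟩ := hdiam z s
    rw [lead_eq (by omega) hs p hp, lead_eq (by omega) hs q hq] at hu
    exact hu rfl

/-! ### The common output -/

variable (K Λ L G ids R) in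
/-- The candidates of `v` at the end of phase `R`. -/
noncomputable def finalCandidates (v : V) : Finset (Finset α) :=
  candidates K Λ (ids v) (walkFamily K Λ (2 * L R) G ids (L R) v)

theorem config_best_succ {i : ℕ} (hi : L R ≤ i) (v : V) :
    ((cutProtocol K Λ L overload).config G ids R (i + 1) v).best =
      leastOf ({((cutProtocol K Λ L overload).config G ids R i v).best} ∪
        cutKey '' (finalCandidates K Λ L G ids R v : Set (Finset α)) ∪
        {b | ∃ u, G.graph.Adj v u ∧
          b = ((cutProtocol K Λ L overload).config G ids R i u).best}) := by
  have h1 : ((cutProtocol K Λ L overload).config G ids R (i + 1) v).best =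
      if i < L R then ⊤ else _ := rfl
  rw [h1, if_neg (not_lt.mpr hi)]
  have h2 := config_family (K := K) (Λ := Λ) (L := L) (overload := overload) (G := G) (ids := ids)
    (R := R) i v
  rw [min_eq_right hi] at h2
  rw [h2]
  congr 2
  ext b
  constructor
  · rintro ⟨j, y, hy, rfl⟩
    obtain ⟨u, rfl, ha, rfl⟩ := heard_eq_some.mp hy
    exact ⟨u, ha, rfl⟩
  · rintro ⟨u, ha, rfl⟩
    exact ⟨ids u, _, heard_eq_some.mpr ⟨u, rfl, ha, rfl⟩, rfl⟩

theorem config_best_cases (i : ℕ) (v : V) :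
    ((cutProtocol K Λ L overload).config G ids R i v).best = ⊤ ∨
      ∃ u, ∃ F ∈ finalCandidates K Λ L G ids R u,
        ((cutProtocol K Λ L overload).config G ids R i v).best = cutKey F := by
  induction i generalizing v with
  | zero => exact .inl rfl
  | succ i ih =>
    by_cases hi : i < L R
    · exact .inl (if_pos hi)
    rw [config_best_succ (not_lt.mp hi)]
    rcases leastOf_mem (S := {((cutProtocol K Λ L overload).config G ids R i v).best} ∪
        cutKey '' (finalCandidates K Λ L G ids R v : Set (Finset α)) ∪
        {b | ∃ u, G.graph.Adj v u ∧
          b = ((cutProtocol K Λ L overload).config G ids R i u).best})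
      with h | (h | ⟨F, hF, h⟩) | ⟨u, -, h⟩
    · exact .inl h
    · rw [Set.mem_singleton_iff.mp h]
      exact ih v
    · exact .inr ⟨v, F, hF, h.symm⟩
    · rw [h]
      exact ih u

/-- The key of a candidate of `u` is taken up by `u` in round `L R`, and then travels to `v` by one
step of a walk in each round. -/
theorem config_best_le {u v : V} {F : Finset α} (hF : F ∈ finalCandidates K Λ L G ids R u)
    (p : G.graph.Walk v u) {i : ℕ} (hi : L R + p.length ≤ i) :
    ((cutProtocol K Λ L overload).config G ids R (i + 1) v).best ≤ cutKey F := by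
  induction p generalizing i with
  | nil =>
    rw [config_best_succ (by omega)]
    exact leastOf_le (.inl (.inr ⟨F, hF, rfl⟩))
  | @cons v w u ha p ih =>
    rw [SimpleGraph.Walk.length_cons] at hi
    obtain ⟨i, rfl⟩ : ∃ i', i = i' + 1 := ⟨i - 1, by omega⟩
    rw [config_best_succ (by omega)]
    exact (leastOf_le (.inr ⟨w, ha, rfl⟩)).trans (ih hF (by omega))

/-- After a successful phase the outputs solve the minimum separator problem. -/
theorem result_spec [Finite V] (hG : G.graph.Connected)
    (hgood : ∀ v, ¬ ((cutProtocol K Λ L overload).config G ids R (L R + 2 * R + 1) v).bad)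
    (hball : ∃ x, ∀ v, ∃ p : G.graph.Walk v x, p.length ≤ R)
    (hshort : ∀ F : Finset α, F.card ≤ Λ → ∀ s v, (K.residual G ids F).Reachable s v →
      ∃ p : (K.residual G ids F).Walk v s, p.length ≤ L R)
    (hadm : ∀ F : Finset α, F.card ≤ Λ → {u | ¬ K.adm (ids u) F}.ncard ≤ Λ)
    (hex : ∃ F : Finset α, K.Separates G ids F ∧ F.card ≤ Λ) :
    ∃ o : V → CutOutput α,
      (∀ v, (cutProtocol K Λ L overload).result R (nodeInfo G ids v)
        ((cutProtocol K Λ L overload).config G ids R (L R + 2 * R + 1) v) = some (o v)) ∧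
      (∃ F, K.IsMinSeparator G ids F ∧ ∀ v, (o v).cut = F) ∧
      (∀ v, ∀ F ∈ (o v).known, K.IsMinSeparator G ids F) ∧
      (∀ F, K.IsMinSeparator G ids F → ∃ v, F ∈ (o v).known) := by
  classical
  have hsound : ∀ v, ∀ F ∈ finalCandidates K Λ L G ids R v, F.card ≤ Λ ∧ K.Separates G ids F :=
    fun v F h => separates_of_mem_candidates hG hshort hadm h
  have hcomplete : ∀ F, K.IsMinSeparator G ids F →
      ∃ v, F ∈ finalCandidates K Λ L G ids R v := by
    intro F hF
    obtain ⟨F', hF', hc⟩ := hex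
    exact exists_mem_candidates hG hshort hadm ((hF.2 F' hF').trans hc) hF
  obtain ⟨M, hM⟩ : ∃ M, K.IsMinSeparator G ids M := by
    obtain ⟨F', hF', -⟩ := hex
    have hne : {F | K.Separates G ids F}.Nonempty := ⟨F', hF'⟩
    exact ⟨Function.argminOn Finset.card _ hne, Function.argminOn_mem Finset.card _ hne,
      fun F hF => Function.argminOn_le Finset.card _ hF⟩
  obtain ⟨vM, hvM⟩ := hcomplete M hM
  have hwalk : ∀ u v : V, ∃ p : G.graph.Walk u v, p.length ≤ 2 * R := by
    intro u v
    obtain ⟨x, hx⟩ := hball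
    obtain ⟨p, hp⟩ := hx u
    obtain ⟨q, hq⟩ := hx v
    refine ⟨p.append q.reverse, ?_⟩
    rw [SimpleGraph.Walk.length_append, SimpleGraph.Walk.length_reverse]
    omega
  set b : V → CutKey := fun v =>
    ((cutProtocol K Λ L overload).config G ids R (L R + 2 * R + 1) v).best with hb
  have hle : ∀ v u, ∀ F ∈ finalCandidates K Λ L G ids R u, b v ≤ cutKey F := by
    intro v u F hF
    obtain ⟨p, hp⟩ := hwalk v u
    exact config_best_le hF p (by omega)
  have hcases : ∀ v, ∃ u, ∃ F ∈ finalCandidates K Λ L G ids R u, b v = cutKey F := by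
    intro v
    refine (config_best_cases _ v).resolve_left fun h => ?_
    exact cutKey_ne_top M (top_le_iff.mp (h ▸ hle v vM M hvM))
  obtain ⟨u₀, C, hC, hCb⟩ := hcases vM
  have hbest : ∀ v, b v = cutKey C := by
    intro v
    obtain ⟨u, F, hF, h⟩ := hcases v
    exact le_antisymm (hle v u₀ C hC) (by rw [h, ← hCb]; exact hle vM u F hF)
  have hCM : C.card ≤ M.card := card_le_of_cutKey_le (hCb ▸ hle vM vM M hvM)
  have hCmin : ∀ F, K.Separates G ids F → C.card ≤ F.card := fun F hF => hCM.trans (hM.2 F hF)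
  have hcut : ∀ v, Function.invFun cutKey (b v) = C := by
    intro v
    rw [hbest v]
    exact Function.leftInverse_invFun cutKey_injective C
  refine ⟨fun v => ⟨C, (finalCandidates K Λ L G ids R v).filter fun F => F.card = C.card⟩,
    fun v => ?_, ⟨C, ⟨(hsound _ C hC).2, hCmin⟩, fun _ => rfl⟩, ?_, ?_⟩
  · refine (if_neg (hgood v)).trans ?_
    have h := config_family (K := K) (Λ := Λ) (L := L) (overload := overload) (G := G) (ids := ids)
      (R := R) (L R + 2 * R + 1) v
    rw [min_eq_right (by omega)] at h
    rw [h, hcut v]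
    rfl
  · intro v F hF
    obtain ⟨hF, hc⟩ := Finset.mem_filter.mp hF
    exact ⟨(hsound v F hF).2, fun F' hF' => hc ▸ hCmin F' hF'⟩
  · intro F hF
    obtain ⟨v, hv⟩ := hcomplete F hF
    exact ⟨v, Finset.mem_filter.mpr ⟨hv,
      le_antisymm (hF.2 C (hsound _ C hC).2) (hCmin F hF.1)⟩⟩

end analysis

/-! ### The length of the messages -/

section codes

variable {α : Type} [DecidableEq α] [Countable α]

/-- A finite set that contains the states that occur in a phase with horizon `l`, for identifiers
smaller than `N` and element names in `U`. -/
noncomputable def codedStates (Λ l N : ℕ) (U : Finset α) : Finset (CutState α) :=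
  letI := Classical.decEq (CutState α)
  (((Finset.range N ×ˢ U.powerset.filter fun P => P.card ≤ 2 * l).powerset.filter fun f =>
      f.card ≤ (Λ + 1) * (2 * l + 1) ^ Λ) ×ˢ (Finset.univ : Finset Prop) ×ˢ
    insert ⊤ ((U.powerset.filter fun F => F.card ≤ Λ).image cutKey)).image
      fun x => ⟨x.1, x.2.1, x.2.2⟩

/-- The number of messages of `k` bits in which the states of a phase with horizon `l` are sent. -/
def chunkCount (Λ l : ℕ) : ℕ :=
  (2 * l + 2) * ((Λ + 1) * (2 * l + 1) ^ Λ) + Λ + 2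

theorem card_codedStates_le {Λ l N k : ℕ} {U : Finset α} (hk : 1 ≤ k) (hN : N ≤ 2 ^ k)
    (hU : U.card + 1 ≤ 2 ^ k) : (codedStates Λ l N U).card ≤ 2 ^ (k * chunkCount Λ l) := by
  classical
  have h2 : 2 ≤ 2 ^ k := by simpa using Nat.pow_le_pow_right two_pos hk
  have hadd : ∀ e, (2 ^ k) ^ e + 1 ≤ (2 ^ k) ^ (e + 1) := by
    intro e
    have := Nat.one_le_pow e (2 ^ k) (by positivity)
    rw [pow_succ]
    nlinarith
  have hbest : (insert ⊤ ((U.powerset.filter fun F => F.card ≤ Λ).image cutKey)).card ≤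
      (2 ^ k) ^ (Λ + 1) :=
    calc _ ≤ (U.card + 1) ^ Λ + 1 := (Finset.card_insert_le _ _).trans
          (Nat.succ_le_succ (Finset.card_image_le.trans (card_filter_card_le U Λ)))
      _ ≤ (2 ^ k) ^ Λ + 1 := by gcongr
      _ ≤ (2 ^ k) ^ (Λ + 1) := hadd Λ
  have hpairs : (Finset.range N ×ˢ U.powerset.filter fun P => P.card ≤ 2 * l).card + 1 ≤
      (2 ^ k) ^ (2 * l + 2) :=
    calc _ ≤ 2 ^ k * (2 ^ k) ^ (2 * l) + 1 := by
          rw [Finset.card_product, Finset.card_range]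
          gcongr
          exact (card_filter_card_le U _).trans (by gcongr)
      _ = (2 ^ k) ^ (2 * l + 1) + 1 := by rw [pow_succ, mul_comm]
      _ ≤ (2 ^ k) ^ (2 * l + 2) := hadd _
  refine Finset.card_image_le.trans ?_
  rw [Finset.card_product, Finset.card_product]
  calc _ ≤ ((2 ^ k) ^ (2 * l + 2)) ^ ((Λ + 1) * (2 * l + 1) ^ Λ) *
        (2 ^ k * (2 ^ k) ^ (Λ + 1)) := by
        gcongr
        · exact (card_filter_card_le _ _).trans (by gcongr)
        · simpa using h2
    _ = 2 ^ (k * chunkCount Λ l) := by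
        rw [← pow_mul, ← pow_succ', ← pow_add, ← pow_mul, chunkCount]
        congr 2

theorem config_mem_codedStates {K : CutKind α} {Λ : ℕ} {L : ℕ → ℕ}
    {overload : ℕ → NodeInfo → Prop} {V : Type} {G : Multigraph V} {ids : V ↪ ℕ} {N : ℕ}
    {U : Finset α} (hids : ∀ v, ids v < N)
    (hU : ∀ a < N, ∀ b < N, ∀ m, ∀ p ∈ K.opts a b m, p ⊆ U) (R i : ℕ) (v : V) :
    (cutProtocol K Λ L overload).config G ids R i v ∈ codedStates Λ (L R) N U := by
  classical
  refine Finset.mem_image.mpr ⟨(_, _, _), ?_, rfl⟩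
  rw [Finset.mem_product, Finset.mem_product]
  refine ⟨?_, Finset.mem_univ _, ?_⟩
  · change CutState.family _ ∈ _
    rw [config_family]
    refine Finset.mem_filter.mpr ⟨Finset.mem_powerset.mpr fun x hx => ?_, card_walkFamily_le⟩
    obtain ⟨hc, s, hs, -⟩ := walkFamily_sound hx
    refine Finset.mem_product.mpr ⟨Finset.mem_range.mpr (hs ▸ hids s), Finset.mem_filter.mpr
      ⟨Finset.mem_powerset.mpr (walkFamily_subset hids hU hx), hc.trans ?_⟩⟩
    exact Nat.mul_le_mul_left _ (min_le_right _ _)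
  · rcases config_best_cases (K := K) (Λ := Λ) (L := L) (overload := overload) (G := G)
      (ids := ids) (R := R) i v with h | ⟨u, F, hF, h⟩
    · exact Finset.mem_insert.mpr (.inl h)
    · refine Finset.mem_insert_of_mem (Finset.mem_image.mpr ⟨F, ?_, h.symm⟩)
      obtain ⟨hsub, hc, -⟩ := Finset.mem_filter.mp hF
      refine Finset.mem_filter.mpr ⟨Finset.mem_powerset.mpr fun e he => ?_, hc⟩
      obtain ⟨x, hx, hex⟩ := Finset.mem_biUnion.mp (Finset.mem_powerset.mp hsub he)
      exact walkFamily_subset hids hU hx hex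

/-- The number of rounds of the compiled protocol up to the end of phase `M`. -/
def runningTime (Λ : ℕ) (L : ℕ → ℕ) (M : ℕ) : ℕ :=
  ∑ R ∈ Finset.range (M + 1), (L R + 2 * R + 1) * chunkCount Λ (L R)

/-- A program that finds all minimum separators of size at most `Λ`. The assumption `hshort` says
that `L R` bounds the lengths of shortest walks after the removal of at most `Λ` elements, provided
that phase `R` succeeds. -/
theorem exists_program (K : CutKind α) (Λ : ℕ) (L : ℕ → ℕ) (overload : ℕ → NodeInfo → Prop)
    (hRL : ∀ R, R ≤ L R) {k N : ℕ} {U : Finset α} (hk : 1 ≤ k) (hN : N ≤ 2 ^ k)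
    (hUk : U.card + 1 ≤ 2 ^ k) (hU : ∀ a < N, ∀ b < N, ∀ m, ∀ p ∈ K.opts a b m, p ⊆ U) :
    ∃ P : CongestProgram (CutOutput α) k, ∀ (V : Type) [Finite V] (G : Multigraph V) (ids : V ↪ ℕ),
      (∀ v, ids v < N) → G.graph.Connected →
      (∀ R, (∃ x, ∀ v, ∃ p : G.graph.Walk v x, p.length ≤ R) →
        (∀ v, ¬ overload R (nodeInfo G ids v)) →
        ∀ F : Finset α, F.card ≤ Λ → ∀ s v, (K.residual G ids F).Reachable s v →
          ∃ p : (K.residual G ids F).Walk v s, p.length ≤ L R) →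
      (∀ F : Finset α, F.card ≤ Λ → {u | ¬ K.adm (ids u) F}.ncard ≤ Λ) →
      (∃ F : Finset α, K.Separates G ids F ∧ F.card ≤ Λ) →
      ∀ M, (∀ u v : V, ∃ p : G.graph.Walk u v, p.length ≤ M) →
        (∀ v, ¬ overload M (nodeInfo G ids v)) →
      ∃ o : V → CutOutput α,
        (∀ ω t, runningTime Λ L M ≤ t → ∀ v, P.outputs G ids ω t v = some (o v)) ∧
        (∃ F, K.IsMinSeparator G ids F ∧ ∀ v, (o v).cut = F) ∧
        (∀ v, ∀ F ∈ (o v).known, K.IsMinSeparator G ids F) ∧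
        (∀ F, K.IsMinSeparator G ids F → ∃ v, F ∈ (o v).known) := by
  classical
  have : Inhabited (CutState α) := ⟨⟨∅, True, ⊤⟩⟩
  choose enc dec henc hdec using fun R =>
    exists_code (codedStates Λ (L R) N U) k _ (card_codedStates_le hk hN hUk)
  refine ⟨(cutProtocol K Λ L overload).compile (fun R => chunkCount Λ (L R)) enc dec, ?_⟩
  intro V _ G ids hids hG hshort hadm hex M hdiam hload
  have := hG.nonempty
  have hsucc : ∃ R, ∀ v,
      ¬ ((cutProtocol K Λ L overload).config G ids R (L R + 2 * R + 1) v).bad :=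
    ⟨M, fun v => phase_succeeds (hRL M) hdiam hload _ v⟩
  set R₀ := Nat.find hsucc with hR₀
  have hR₀M : R₀ ≤ M := Nat.find_min' hsucc fun v => phase_succeeds (hRL M) hdiam hload _ v
  have hgood := Nat.find_spec hsucc
  rw [← hR₀] at hgood
  obtain ⟨v₀⟩ := hG.nonempty
  obtain ⟨-, hload₀, hball⟩ := (phase_dichotomy (K := K) (Λ := Λ) (L := L)
    (overload := overload) (ids := ids) hG (hRL R₀)).resolve_left fun h => hgood v₀ (h v₀)
  obtain ⟨o, hres, hspec⟩ := result_spec hG hgood hball (hshort R₀ hball hload₀) hadm hex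
  refine ⟨o, fun ω t ht v => ?_, hspec⟩
  refine PhasedProtocol.outputs_compile (R₀ := R₀) (fun R => ?_) (fun R => Nat.succ_pos _) henc
    (fun R i _ v => hdec R _ (config_mem_codedStates hids hU R i v)) (fun R hR v => ?_) hres ω ?_ v
  · exact Nat.succ_pos _
  · refine if_pos ?_
    rcases phase_dichotomy (K := K) (Λ := Λ) (L := L) (overload := overload) (ids := ids) hG
      (hRL R) with h | h
    · exact h v
    · exact absurd h.1 (Nat.find_min hsucc hR)
  · refine le_trans ?_ ht
    exact Finset.sum_le_sum_of_subset (Finset.range_mono (by omega))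

end codes

/-! ### Polynomial running time -/

/-- `f` is at most a polynomial, in a form that is monotone and positive also at `0`. -/
def PolyBounded (f : ℕ → ℕ) : Prop :=
  ∃ C e, ∀ R, f R ≤ C * (R + 1) ^ e

namespace PolyBounded

variable {f g : ℕ → ℕ}

theorem const (C : ℕ) : PolyBounded fun _ => C :=
  ⟨C, 0, fun R => by simp⟩

theorem id : PolyBounded fun R => R :=
  ⟨1, 1, fun R => by simp⟩

theorem add (hf : PolyBounded f) (hg : PolyBounded g) : PolyBounded fun R => f R + g R := by
  obtain ⟨C, e, hC⟩ := hf
  obtain ⟨C', e', hC'⟩ := hg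
  refine ⟨C + C', max e e', fun R => ?_⟩
  rw [add_mul]
  refine add_le_add ((hC R).trans ?_) ((hC' R).trans ?_)
  · gcongr
    · omega
    · exact le_max_left _ _
  · gcongr
    · omega
    · exact le_max_right _ _

theorem mul (hf : PolyBounded f) (hg : PolyBounded g) : PolyBounded fun R => f R * g R := by
  obtain ⟨C, e, hC⟩ := hf
  obtain ⟨C', e', hC'⟩ := hg
  refine ⟨C * C', e + e', fun R => (Nat.mul_le_mul (hC R) (hC' R)).trans (le_of_eq ?_)⟩
  rw [pow_add]
  ring

theorem pow (hf : PolyBounded f) (e : ℕ) : PolyBounded fun R => f R ^ e := by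
  induction e with
  | zero => simpa using const 1
  | succ e ih => simpa only [pow_succ] using ih.mul hf

end PolyBounded

theorem exists_runningTime_le (Λ : ℕ) {L : ℕ → ℕ} (hL : PolyBounded L) :
    ∃ c, ∀ M, 1 ≤ M → runningTime Λ L M ≤ c * M ^ c := by
  have hpoly : PolyBounded fun R => (L R + 2 * R + 1) * chunkCount Λ (L R) := by
    unfold chunkCount
    refine ((hL.add ((PolyBounded.const 2).mul PolyBounded.id)).add (.const 1)).mul ?_
    exact (((((PolyBounded.const 2).mul hL).add (.const 2)).mul ((PolyBounded.const (Λ + 1)).mul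
      ((((PolyBounded.const 2).mul hL).add (.const 1)).pow Λ))).add (.const Λ)).add (.const 2)
  obtain ⟨C, e, hC⟩ := hpoly
  refine ⟨C * 2 ^ (e + 1) + e + 1, fun M hM => ?_⟩
  calc runningTime Λ L M ≤ ∑ _R ∈ Finset.range (M + 1), C * (M + 1) ^ e := by
        refine Finset.sum_le_sum fun R hR => (hC R).trans ?_
        have := Finset.mem_range.mp hR
        gcongr
        omega
    _ = C * (M + 1) ^ (e + 1) := by
        rw [Finset.sum_const, Finset.card_range, smul_eq_mul, pow_succ]
        ring
    _ ≤ C * (2 * M) ^ (e + 1) := by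
        gcongr
        omega
    _ = C * 2 ^ (e + 1) * M ^ (e + 1) := by rw [mul_pow, mul_assoc]
    _ ≤ _ := by
        gcongr
        · omega
        · omega

/-! ### From separators to cuts, and from certain outputs to probabilities -/

/-- Minimum cuts correspond to minimum separators, if each small cut is a separator and each small
separator contains a cut. -/
theorem minCut_correspondence {X α : Type} [DecidableEq α] {Cut : Finset X → Prop}
    {Sep : Finset α → Prop} {name : X → α} (hname : Function.Injective name) {Λ : ℕ}
    (h1 : ∀ C, Cut C → C.card ≤ Λ → Sep (C.image name))
    (h2 : ∀ F, Sep F → F.card ≤ Λ → ∃ C, Cut C ∧ C.image name ⊆ F)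
    (hex : ∃ C, Cut C ∧ C.card ≤ Λ) :
    (∃ F, Sep F ∧ F.card ≤ Λ) ∧
    (∀ C, (Cut C ∧ ∀ C', Cut C' → C.card ≤ C'.card) →
      Sep (C.image name) ∧ ∀ F, Sep F → (C.image name).card ≤ F.card) ∧
    (∀ F, (Sep F ∧ ∀ F', Sep F' → F.card ≤ F'.card) →
      ∃ C, (Cut C ∧ ∀ C', Cut C' → C.card ≤ C'.card) ∧ F = C.image name) := by
  have hcard : ∀ C : Finset X, (C.image name).card = C.card :=
    fun C => Finset.card_image_of_injective C hname
  obtain ⟨C₀, hC₀, hc₀⟩ := hex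
  refine ⟨⟨_, h1 C₀ hC₀ hc₀, (hcard C₀).trans_le hc₀⟩, fun C hC => ?_, fun F hF => ?_⟩
  · have hCΛ : C.card ≤ Λ := (hC.2 C₀ hC₀).trans hc₀
    refine ⟨h1 C hC.1 hCΛ, fun F hF => ?_⟩
    rw [hcard]
    by_contra! hlt
    obtain ⟨C', hC', hsub⟩ := h2 F hF (by omega)
    have h3 := Finset.card_le_card hsub
    have h4 := hC.2 C' hC'
    rw [hcard] at h3
    omega
  · have hF₀ := hF.2 _ (h1 C₀ hC₀ hc₀)
    rw [hcard] at hF₀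
    obtain ⟨C, hC, hsub⟩ := h2 F hF.1 (by omega)
    have hCF := Finset.card_le_card hsub
    rw [hcard] at hCF
    have heq := Finset.eq_of_subset_of_card_le hsub (hF.2 _ (h1 C hC (by omega)))
    refine ⟨C, ⟨hC, fun C' hC' => ?_⟩, heq.symm⟩
    by_contra! hlt
    have h3 := hF.2 _ (h1 C' hC' (by omega))
    rw [hcard] at h3
    omega

theorem CongestProgram.halts_and_prob {Out : Type} {k : ℕ} {P : CongestProgram Out k} {V : Type}
    [Finite V] {G : Multigraph V} {ids : V ↪ ℕ} {t : ℕ} {E : P.Tape V → Prop} (x : ℝ) (hx : 0 ≤ x)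
    (hhalt : ∀ ω v, P.outputs G ids ω t v ≠ none) (hE : ∀ ω, E ω) :
    P.HaltsWithin G ids t ∧ 1 - 1 / x ≤ P.prob V E := by
  refine ⟨hhalt, ?_⟩
  have h1 : Nat.card {ω : P.Tape V // E ω} = Nat.card (P.Tape V) :=
    Nat.card_congr (Equiv.subtypeUnivEquiv hE)
  have h2 : (Nat.card (P.Tape V) : ℝ) ≠ 0 := by
    exact_mod_cast Nat.card_pos.ne'
  rw [CongestProgram.prob, h1, div_self h2, sub_le_self_iff]
  positivity

theorem solvesMinCut {α V X : Type} [DecidableEq α] {K : CutKind α} {G : Multigraph V} {ids : V ↪ ℕ}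
    {IsMinCut : Finset X → Prop} {name : X → α}
    (hmin : ∀ C, IsMinCut C → K.IsMinSeparator G ids (C.image name))
    (hsep : ∀ F, K.IsMinSeparator G ids F → ∃ C, IsMinCut C ∧ F = C.image name)
    {o : V → CutOutput α} {out : V → Option (CutOutput α)} (hout : ∀ v, out v = some (o v))
    (hcut : ∃ F, K.IsMinSeparator G ids F ∧ ∀ v, (o v).cut = F)
    (hknown : ∀ v, ∀ F ∈ (o v).known, K.IsMinSeparator G ids F)
    (hall : ∀ F, K.IsMinSeparator G ids F → ∃ v, F ∈ (o v).known) :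
    SolvesMinCut IsMinCut name out := by
  refine ⟨o, hout, ?_, fun v Y hY => hsep Y (hknown v Y hY), fun C hC => hall _ (hmin C hC)⟩
  obtain ⟨F, hF, h⟩ := hcut
  obtain ⟨C, hC, rfl⟩ := hsep F hF
  exact ⟨C, hC, h⟩

/-- A walk in `G` to a vertex of `Z` stays in the subgraph `H` until it reaches `Z`, if the vertices
at which it can leave `H` belong to `Z`. -/
theorem exists_walk_to_cover {V : Type} {G H : SimpleGraph V} {Z : Finset V} {good : V → Prop}
    (hZ : ∀ x y, G.Adj x y → ¬ H.Adj x y → good x → x ∈ Z)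
    (hgood : ∀ x y, H.Adj x y → good x → good y) {x r : V} (hr : r ∈ Z) (p : G.Walk x r)
    (hx : good x) : ∃ z ∈ Z, ∃ q : H.Walk x z, q.length ≤ p.length := by
  induction p with
  | nil => exact ⟨_, hr, .nil, le_rfl⟩
  | @cons x y r h p ih =>
    by_cases hxy : H.Adj x y
    · obtain ⟨z, hz, q, hq⟩ := ih hr (hgood x y hxy hx)
      exact ⟨z, hz, .cons hxy q, by simpa using hq⟩
    · exact ⟨x, hZ x y h hxy hx, .nil, Nat.zero_le _⟩

theorem exists_walk_le_diam {V : Type} [Finite V] {G : Multigraph V} (hG : G.graph.Connected)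
    (u v : V) : ∃ p : G.graph.Walk u v, p.length ≤ G.diam := by
  have := hG.nonempty
  obtain ⟨p, hp⟩ := hG.exists_walk_length_eq_dist u v
  refine ⟨p, hp.trans_le ?_⟩
  exact SimpleGraph.dist_le_diam (SimpleGraph.connected_iff_ediam_ne_top.mp hG)

/-! ### Edge cuts -/

theorem edgeName_injective {V : Type} (ids : V ↪ ℕ) : Function.Injective (edgeName ids) := by
  rintro ⟨p, i⟩ ⟨q, j⟩ h
  obtain ⟨h1, h2⟩ := Prod.mk.inj h
  exact Prod.ext (Sym2.map.injective ids.injective h1) h2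

/-- Edge cuts with at most `Λ` edges. Of more than `Λ` parallel edges only `Λ + 1` are taken into
account, which is enough for some of them to survive. -/
def edgeCutKind (Λ : ℕ) : CutKind (Sym2 ℕ × ℕ) where
  opts a b m := (Finset.range (min m (Λ + 1))).image fun j => {(s(a, b), j)}
  opts_comm a b m := by rw [Sym2.eq_swap]
  opts_nonempty a b m hm := by
    rw [Finset.image_nonempty, Finset.nonempty_range_iff]
    omega
  card_le_two a b m p hp := by
    obtain ⟨j, -, rfl⟩ := Finset.mem_image.mp hp
    simp
  adm _ _ := True
  adm_mono _ h := h

section edges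

variable {V : Type} {G : Multigraph V} {ids : V ↪ ℕ} {Λ : ℕ} {F : Finset (Sym2 ℕ × ℕ)}

theorem residual_edge_adj {v u : V} : ((edgeCutKind Λ).residual G ids F).Adj v u ↔
    ∃ j, j < G.mult s(v, u) ∧ j ≤ Λ ∧ (s(ids v, ids u), j) ∉ F := by
  constructor
  · rintro ⟨-, p, hp, hd⟩
    obtain ⟨j, hj, rfl⟩ := Finset.mem_image.mp hp
    have := Finset.mem_range.mp hj
    exact ⟨j, by omega, by omega, Finset.disjoint_singleton_left.mp hd⟩
  · rintro ⟨j, hj, hjΛ, hjF⟩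
    refine ⟨Multigraph.graph_adj.mpr (by omega), _, Finset.mem_image.mpr ⟨j, ?_, rfl⟩,
      Finset.disjoint_singleton_left.mpr hjF⟩
    rw [Finset.mem_range]
    omega

theorem deleteEdges_adj {C : Finset (Sym2 V × ℕ)} {v u : V} :
    (G.deleteEdges C).Adj v u ↔ ∃ j, j < G.mult s(v, u) ∧ (s(v, u), j) ∉ C := by
  rw [Multigraph.deleteEdges, SimpleGraph.fromEdgeSet_adj]
  refine and_iff_left_of_imp ?_
  rintro ⟨j, hj, -⟩ rfl
  have : j < G.mult s(v, v) := hj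
  simp [G.mult_diag] at this

theorem separates_of_isEdgeCut {C : Finset (Sym2 V × ℕ)} (hC : G.IsEdgeCut C) :
    (edgeCutKind Λ).Separates G ids (C.image (edgeName ids)) := by
  have h := hC.2
  simp only [SimpleGraph.Preconnected] at h
  push Not at h
  obtain ⟨s, v, hsv⟩ := h
  refine ⟨s, v, trivial, trivial, fun hr => hsv (hr.mono fun x y hxy => ?_)⟩
  obtain ⟨j, hj, -, hjC⟩ := residual_edge_adj.mp hxy
  exact deleteEdges_adj.mpr ⟨j, hj, fun h => hjC (Finset.mem_image.mpr ⟨_, h, rfl⟩)⟩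

/-- If two vertices stay connected by one of more than `Λ` parallel edges, they are also connected by
one of the first `Λ + 1` of them that is not in `F`. -/
theorem exists_isEdgeCut (hF : F.card ≤ Λ) (hsep : (edgeCutKind Λ).Separates G ids F) :
    ∃ C, G.IsEdgeCut C ∧ C.image (edgeName ids) ⊆ F := by
  classical
  obtain ⟨s, v, -, -, hsv⟩ := hsep
  refine ⟨(F.preimage _ (edgeName_injective ids).injOn).filter (· ∈ G.edges),
    ⟨fun e he => (Finset.mem_filter.mp he).2, fun h => hsv ((h s v).mono fun x y hxy => ?_)⟩, ?_⟩
  · obtain ⟨j, hj, hjC⟩ := deleteEdges_adj.mp hxy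
    rw [residual_edge_adj]
    by_cases hjΛ : j ≤ Λ
    · refine ⟨j, hj, hjΛ, fun h => hjC ?_⟩
      exact Finset.mem_filter.mpr ⟨Finset.mem_preimage.mpr h, hj⟩
    · obtain ⟨e, he, heF⟩ := Finset.exists_mem_notMem_of_card_lt_card (s := F)
        (t := (Finset.range (Λ + 1)).image fun i => (s(ids x, ids y), i)) (by
          rw [Finset.card_image_of_injective _ (Prod.mk_right_injective _), Finset.card_range]
          omega)
      obtain ⟨i, hi, rfl⟩ := Finset.mem_image.mp he
      have := Finset.mem_range.mp hi
      exact ⟨i, by omega, by omega, heF⟩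
  · intro e he
    obtain ⟨e', he', rfl⟩ := Finset.mem_image.mp he
    exact Finset.mem_preimage.mp (Finset.mem_filter.mp he').1

/-- The removed edges have at most `2 * Λ` end points, which together with `r` cover the rest of
the graph by balls of radius `R`. -/
theorem exists_short_walk_edges [Finite V] {R : ℕ}
    (hball : ∃ r, ∀ v, ∃ p : G.graph.Walk v r, p.length ≤ R) (hF : F.card ≤ Λ) {s v : V}
    (hsv : ((edgeCutKind Λ).residual G ids F).Reachable s v) :
    ∃ p : ((edgeCutKind Λ).residual G ids F).Walk v s,
      p.length ≤ (2 * Λ + 1) * (2 * R + 1) := by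
  classical
  have := Fintype.ofFinite V
  obtain ⟨r, hr⟩ := hball
  set Z : Finset V := insert r (F.biUnion fun e => Finset.univ.filter fun v => ids v ∈ e.1) with hZ
  have hZcard : Z.card ≤ 2 * Λ + 1 := by
    refine (Finset.card_insert_le _ _).trans (Nat.succ_le_succ ?_)
    refine (Finset.card_biUnion_le_card_mul _ _ 2 fun e _ => ?_).trans (by omega)
    obtain ⟨p, j⟩ := e
    induction p with
    | _ a b =>
      refine (Finset.card_le_card_of_injOn ids (t := {a, b}) (fun v hv => ?_)
        ids.injective.injOn).trans Finset.card_le_two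
      simpa using hv
  have hleave : ∀ x y, G.graph.Adj x y → ¬ ((edgeCutKind Λ).residual G ids F).Adj x y →
      True → x ∈ Z := by
    intro x y hxy hn _
    have h0 : (s(ids x, ids y), 0) ∈ F := by
      by_contra h
      exact hn (residual_edge_adj.mpr ⟨0, Multigraph.graph_adj.mp hxy, Nat.zero_le _, h⟩)
    exact Finset.mem_insert_of_mem (Finset.mem_biUnion.mpr ⟨_, h0, by simp⟩)
  obtain ⟨p, hp⟩ := exists_short_walk hsv Z R fun x _ => by
    obtain ⟨p, hp⟩ := hr x
    obtain ⟨z, hz, q, hq⟩ := exists_walk_to_cover (good := fun _ => True) hleave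
      (fun _ _ _ _ => trivial) (Finset.mem_insert_self _ _) p trivial
    exact ⟨z, hz, q, hq.trans hp⟩
  exact ⟨p, hp.trans (Nat.mul_le_mul_right _ hZcard)⟩

end edges

/-! ### Vertex cuts -/

/-- Vertex cuts. A step uses both of its end points. A walk of length `0` uses nothing, so `adm` has
to exclude the removed vertices. -/
def vertexCutKind : CutKind ℕ where
  opts a b _ := {{a, b}}
  opts_comm a b _ := by rw [Finset.pair_comm]
  opts_nonempty _ _ _ _ := Finset.singleton_nonempty _
  card_le_two a b _ p hp := by
    obtain rfl := Finset.mem_singleton.mp hp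
    exact Finset.card_le_two
  adm a F := a ∉ F
  adm_mono hF ha h := ha (hF h)

section vertices

variable {V : Type} {G : Multigraph V} {ids : V ↪ ℕ} {F : Finset ℕ}

theorem residual_vertex_adj {v u : V} : (vertexCutKind.residual G ids F).Adj v u ↔
    G.graph.Adj v u ∧ ids v ∉ F ∧ ids u ∉ F := by
  refine and_congr_right fun _ => ?_
  simp [vertexCutKind]

theorem separates_of_isVertexCut {S : Finset V} (hS : G.IsVertexCut S) :
    vertexCutKind.Separates G ids (S.image ids) := by
  have h := hS
  simp only [Multigraph.IsVertexCut, SimpleGraph.Preconnected] at h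
  push Not at h
  obtain ⟨⟨s, hs⟩, ⟨v, hv⟩, hsv⟩ := h
  have hmem : ∀ u : V, ids u ∈ S.image ids ↔ u ∈ S := fun u => by simp
  refine ⟨s, v, (hmem s).not.mpr hs, (hmem v).not.mpr hv, fun hr => hsv ?_⟩
  obtain ⟨p⟩ := hr
  clear hsv
  induction p with
  | nil => exact .rfl
  | @cons x y z h p ih =>
    obtain ⟨ha, -, hy⟩ := residual_vertex_adj.mp h
    have hy' : y ∉ S := (hmem y).not.mp hy
    have hxy : (G.graph.induce {v | v ∉ S}).Adj ⟨x, hs⟩ ⟨y, hy'⟩ := ha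
    exact hxy.reachable.trans (ih hy' hv)

theorem exists_isVertexCut (hsep : vertexCutKind.Separates G ids F) :
    ∃ S, G.IsVertexCut S ∧ S.image ids ⊆ F := by
  obtain ⟨s, v, hs, hv, hsv⟩ := hsep
  set S := F.preimage ids ids.injective.injOn with hS
  have hmem : ∀ u : V, u ∉ S ↔ ids u ∉ F := fun u => by simp [hS]
  refine ⟨S, fun h => hsv ?_, fun e he => ?_⟩
  · let f : G.graph.induce {v | v ∉ S} →g vertexCutKind.residual G ids F :=
      ⟨Subtype.val, fun {x y} h => residual_vertex_adj.mpr
        ⟨h, (hmem _).mp x.2, (hmem _).mp y.2⟩⟩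
    exact (h ⟨s, (hmem s).mpr hs⟩ ⟨v, (hmem v).mpr hv⟩).map f
  · obtain ⟨u, hu, rfl⟩ := Finset.mem_image.mp he
    exact Finset.mem_preimage.mp hu

theorem ncard_links_eq [Fintype V] [DecidableRel G.graph.Adj] (v : V) :
    {j | 0 < (nodeInfo G ids v).2 j}.ncard = (Finset.univ.filter (G.graph.Adj v)).card := by
  rw [← Set.ncard_coe_finset, ← Set.ncard_image_of_injective _ ids.injective]
  congr 1
  ext j
  by_cases hj : ∃ u, ids u = j
  · obtain ⟨u, rfl⟩ := hj
    simp [nodeInfo, links_apply, Multigraph.graph_adj]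
  · have h0 := links_eq_zero (G := G) (v := v) hj
    simp only [nodeInfo, Set.mem_ofPred_eq, h0, lt_irrefl, false_iff]
    rintro ⟨u, -, rfl⟩
    exact hj ⟨u, rfl⟩

/-- The neighbours of the at most `Λ` removed vertices cover the rest of the graph, together
with `r`, by balls of radius `R`. -/
theorem exists_short_walk_vertices [Finite V] {Λ R : ℕ}
    (hball : ∃ r, ∀ v, ∃ p : G.graph.Walk v r, p.length ≤ R)
    (hdeg : ∀ v, ¬ R < {j | 0 < (nodeInfo G ids v).2 j}.ncard) (hF : F.card ≤ Λ) {s v : V}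
    (hsv : (vertexCutKind.residual G ids F).Reachable s v) :
    ∃ p : (vertexCutKind.residual G ids F).Walk v s, p.length ≤ (Λ * R + 1) * (2 * R + 1) := by
  classical
  have := Fintype.ofFinite V
  by_cases hs : ids s ∈ F
  · obtain ⟨p⟩ := hsv
    cases p with
    | nil => exact ⟨.nil, Nat.zero_le _⟩
    | cons h p => exact absurd hs (residual_vertex_adj.mp h).2.1
  obtain ⟨r, hr⟩ := hball
  set Z : Finset V := insert r ((F.preimage ids ids.injective.injOn).biUnion fun w =>
    Finset.univ.filter (G.graph.Adj w)) with hZ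
  have hZcard : Z.card ≤ Λ * R + 1 := by
    refine (Finset.card_insert_le _ _).trans (Nat.succ_le_succ ?_)
    refine (Finset.card_biUnion_le_card_mul _ _ R fun w _ => ?_).trans ?_
    · rw [← ncard_links_eq (ids := ids)]
      exact not_lt.mp (hdeg w)
    · gcongr
      exact (Finset.card_le_card_of_injOn ids (by intro x hx; simpa using hx)
        ids.injective.injOn).trans hF
  have hleave : ∀ x y, G.graph.Adj x y → ¬ (vertexCutKind.residual G ids F).Adj x y →
      ids x ∉ F → x ∈ Z := by
    intro x y hxy hn hxF
    have hy : ids y ∈ F := by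
      by_contra h
      exact hn (residual_vertex_adj.mpr ⟨hxy, hxF, h⟩)
    exact Finset.mem_insert_of_mem (Finset.mem_biUnion.mpr
      ⟨y, Finset.mem_preimage.mpr hy, by simpa using hxy.symm⟩)
  have hgood : ∀ x y, (vertexCutKind.residual G ids F).Adj x y → ids x ∉ F → ids y ∉ F :=
    fun x y h _ => (residual_vertex_adj.mp h).2.2
  obtain ⟨p, hp⟩ := exists_short_walk hsv Z R fun x hx => by
    have hxF : ids x ∉ F := by
      obtain ⟨q⟩ := hx
      clear hsv
      induction q with
      | nil => exact hs
      | cons h q ih => exact ih (hgood _ _ h hs)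
    obtain ⟨p, hp⟩ := hr x
    obtain ⟨z, hz, q, hq⟩ := exists_walk_to_cover (good := fun x => ids x ∉ F) hleave hgood
      (Finset.mem_insert_self _ _) p hxF
    exact ⟨z, hz, q, hq.trans hp⟩
  exact ⟨p, hp.trans (Nat.mul_le_mul_right _ hZcard)⟩

end vertices

/-! ### The two algorithms -/

theorem exists_card_le_of_iInf_le {X : Type} {Cut : Finset X → Prop} {Λ : ℕ}
    (h : ⨅ F : {F : Finset X // Cut F}, (F.1.card : ℕ∞) ≤ (Λ : ℕ∞)) :
    ∃ C, Cut C ∧ C.card ≤ Λ := by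
  have hlt : ⨅ F : {F : Finset X // Cut F}, (F.1.card : ℕ∞) < ((Λ + 1 : ℕ) : ℕ∞) :=
    h.trans_lt (by exact_mod_cast Nat.lt_succ_self Λ)
  obtain ⟨⟨C, hC⟩, hlt⟩ := iInf_lt_iff.mp hlt
  exact ⟨C, hC, Nat.lt_succ_iff.mp (by exact_mod_cast hlt)⟩

theorem pow_le_two_pow_clog {n : ℕ} (e : ℕ) : n ^ e ≤ 2 ^ (e * Nat.clog 2 n) := by
  rw [mul_comm, pow_mul]
  exact Nat.pow_le_pow_left (Nat.le_pow_clog one_lt_two n) e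

theorem le_two_pow_mul_clog {n : ℕ} (hn : 2 ≤ n) (e : ℕ) : e ≤ 2 ^ (e * Nat.clog 2 n) :=
  Nat.lt_two_pow_self.le.trans (Nat.pow_le_pow_right two_pos
    (Nat.le_mul_of_pos_right _ (Nat.clog_pos one_lt_two hn)))

/-- A program of the type that is needed for the number of nodes `n = 0, 1`, where no graph has
a cut. -/
def idleProgram (Out : Type) (k : ℕ) : CongestProgram Out k :=
  ⟨Unit, 0, fun _ _ _ => (), fun _ _ _ => false, fun _ _ => (), fun _ => none⟩

theorem one_lt_card_of_not_preconnected {V : Type} [Fintype V] {H : SimpleGraph V}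
    (h : ¬ H.Preconnected) : 2 ≤ Fintype.card V := by
  by_contra hlt
  have : Subsingleton V := Fintype.card_le_one_iff_subsingleton.mp (by omega)
  exact h SimpleGraph.Preconnected.of_subsingleton

theorem one_le_diam {V : Type} [Fintype V] {G : Multigraph V} (hG : G.graph.Connected)
    (hn : 2 ≤ Fintype.card V) : 1 ≤ G.diam := by
  have : Nontrivial V := Fintype.one_lt_card_iff_nontrivial.mp hn
  exact Nat.one_le_iff_ne_zero.mpr (SimpleGraph.connected_iff_diam_ne_zero.mp hG)

theorem ncard_links_le_maxDegree {V : Type} [Fintype V] {G : Multigraph V} {ids : V ↪ ℕ} (v : V) :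
    {j | 0 < (nodeInfo G ids v).2 j}.ncard ≤ G.maxDegree := by
  classical
  rw [ncard_links_eq]
  refine le_trans ?_ (Finset.le_sup (Finset.mem_univ v))
  rw [Multigraph.degree, Finset.card_filter]
  refine Finset.sum_le_sum fun u _ => ?_
  split_ifs with h
  · exact Multigraph.graph_adj.mp h
  · exact Nat.zero_le _

theorem one_le_maxDegree {V : Type} [Fintype V] {G : Multigraph V} (hG : G.graph.Connected)
    (hn : 2 ≤ Fintype.card V) : 1 ≤ G.maxDegree := by
  have : Nontrivial V := Fintype.one_lt_card_iff_nontrivial.mp hn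
  obtain ⟨v⟩ := hG.nonempty
  obtain ⟨u, hu⟩ := hG.preconnected.exists_adj_of_nontrivial v
  calc 1 ≤ G.mult s(v, u) := Multigraph.graph_adj.mp hu
    _ ≤ G.degree v := Finset.single_le_sum (f := fun u => G.mult s(v, u))
        (fun _ _ => Nat.zero_le _) (Finset.mem_univ u)
    _ ≤ G.maxDegree := Finset.le_sup (Finset.mem_univ v)

theorem exists_minEdgeCut_programs (Λ a : ℕ) :
    ∃ (c B : ℕ) (P : ∀ n : ℕ, CongestProgram (CutOutput (Sym2 ℕ × ℕ)) (B * Nat.clog 2 n)),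
      ∀ (V : Type) [Fintype V] (G : Multigraph V) (ids : V ↪ ℕ),
        (∀ v, ids v < Fintype.card V ^ a) → G.graph.Connected →
        G.edgeConnectivity ≤ (Λ : ℕ∞) →
          ∀ ω, SolvesMinCut G.IsMinEdgeCut (edgeName ids)
            ((P (Fintype.card V)).outputs G ids ω (c * G.diam ^ c)) := by
  classical
  set L : ℕ → ℕ := fun R => (2 * Λ + 1) * (2 * R + 1) with hL
  obtain ⟨c, hc⟩ := exists_runningTime_le Λ (L := L)
    ((PolyBounded.const _).mul (((PolyBounded.const 2).mul .id).add (.const 1)))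
  set B := 2 * a + (Λ + 2) with hB
  let U : ℕ → Finset (Sym2 ℕ × ℕ) := fun N =>
    ((Finset.range N ×ˢ Finset.range N) ×ˢ Finset.range (Λ + 1)).image
      fun x => (s(x.1.1, x.1.2), x.2)
  have hprog : ∀ n, 2 ≤ n → _ := fun n (hn : 2 ≤ n) =>
    exists_program (edgeCutKind Λ) Λ L (fun _ _ => False)
      (fun R => by simp only [hL]; nlinarith) (k := B * Nat.clog 2 n) (N := n ^ a) (U := U (n ^ a))
      (Nat.one_le_iff_ne_zero.mpr (Nat.mul_ne_zero (by omega)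
        (Nat.clog_pos one_lt_two hn).ne'))
      ((pow_le_two_pow_clog a).trans (Nat.pow_le_pow_right two_pos
        (Nat.mul_le_mul_right _ (by omega))))
      (by
        have hpos : 1 ≤ n ^ a * n ^ a := Nat.succ_le_of_lt (by positivity)
        calc (U (n ^ a)).card + 1 ≤ n ^ a * n ^ a * (Λ + 1) + 1 := by
              refine Nat.succ_le_succ (Finset.card_image_le.trans (le_of_eq ?_))
              simp
          _ ≤ n ^ (2 * a) * (Λ + 2) := by
              rw [two_mul, pow_add]
              linarith
          _ ≤ 2 ^ (2 * a * Nat.clog 2 n) * 2 ^ ((Λ + 2) * Nat.clog 2 n) :=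
              Nat.mul_le_mul (pow_le_two_pow_clog _) (le_two_pow_mul_clog hn _)
          _ = 2 ^ (B * Nat.clog 2 n) := by rw [← pow_add, ← add_mul])
      (by
        intro x hx y hy m p hp e he
        obtain ⟨j, hj, rfl⟩ := Finset.mem_image.mp hp
        obtain rfl := Finset.mem_singleton.mp he
        have := Finset.mem_range.mp hj
        refine Finset.mem_image.mpr ⟨((x, y), j), ?_, rfl⟩
        simp only [Finset.mem_product, Finset.mem_range]
        exact ⟨⟨hx, hy⟩, by omega⟩)
  choose P hP using hprog
  refine ⟨c, B, fun n => if hn : 2 ≤ n then P n hn else idleProgram _ _, ?_⟩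
  intro V _ G ids hids hG hcon
  obtain ⟨C₀, hC₀, hc₀⟩ := exists_card_le_of_iInf_le hcon
  have hn := one_lt_card_of_not_preconnected hC₀.2
  beta_reduce
  rw [dif_pos hn]
  obtain ⟨hex, hmin, hsep⟩ := minCut_correspondence (edgeName_injective ids)
    (fun C hC _ => separates_of_isEdgeCut (Λ := Λ) hC)
    (fun F hF hFc => exists_isEdgeCut hFc hF) ⟨C₀, hC₀, hc₀⟩
  obtain ⟨o, ho, hcut, hknown, hall⟩ := hP _ hn V G ids hids hG
    (fun R hball _ F hF s v hsv => exists_short_walk_edges hball hF hsv)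
    (fun F _ => by simp [edgeCutKind]) hex G.diam (exists_walk_le_diam hG) (fun _ h => h)
  intro ω
  exact solvesMinCut hmin hsep (ho ω _ (hc _ (one_le_diam hG hn))) hcut hknown hall

theorem exists_minVertexCut_programs (Λ a : ℕ) :
    ∃ (c B : ℕ) (P : ∀ n : ℕ, CongestProgram (CutOutput ℕ) (B * Nat.clog 2 n)),
      ∀ (V : Type) [Fintype V] (G : Multigraph V) (ids : V ↪ ℕ),
        (∀ v, ids v < Fintype.card V ^ a) → G.graph.Connected →
        G.vertexConnectivity ≤ (Λ : ℕ∞) →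
          ∀ ω, SolvesMinCut G.IsMinVertexCut ids
            ((P (Fintype.card V)).outputs G ids ω (c * (G.diam * G.maxDegree) ^ c)) := by
  classical
  set L : ℕ → ℕ := fun R => (Λ * R + 1) * (2 * R + 1) with hL
  obtain ⟨c, hc⟩ := exists_runningTime_le Λ (L := L)
    ((((PolyBounded.const _).mul .id).add (.const 1)).mul
      (((PolyBounded.const 2).mul .id).add (.const 1)))
  have hprog : ∀ n, 2 ≤ n → _ := fun n (hn : 2 ≤ n) =>
    exists_program vertexCutKind Λ L (fun R I => R < {j | 0 < I.2 j}.ncard)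
      (fun R => by simp only [hL]; nlinarith [Nat.zero_le (Λ * R * (2 * R + 1))])
      (k := (a + 1) * Nat.clog 2 n) (N := n ^ a) (U := Finset.range (n ^ a))
      (Nat.one_le_iff_ne_zero.mpr (Nat.mul_ne_zero (by omega)
        (Nat.clog_pos one_lt_two hn).ne'))
      ((pow_le_two_pow_clog a).trans (Nat.pow_le_pow_right two_pos
        (Nat.mul_le_mul_right _ (by omega))))
      (by
        have hpos : 1 ≤ n ^ a := Nat.succ_le_of_lt (by positivity)
        calc (Finset.range (n ^ a)).card + 1 ≤ n ^ a * n := by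
              rw [Finset.card_range]
              nlinarith
          _ = n ^ (a + 1) := (pow_succ n a).symm
          _ ≤ 2 ^ ((a + 1) * Nat.clog 2 n) := pow_le_two_pow_clog _)
      (by
        intro x hx y hy m p hp e he
        obtain rfl := Finset.mem_singleton.mp hp
        rcases Finset.mem_insert.mp he with rfl | he
        · exact Finset.mem_range.mpr hx
        · obtain rfl := Finset.mem_singleton.mp he
          exact Finset.mem_range.mpr hy)
  choose P hP using hprog
  refine ⟨c, a + 1, fun n => if hn : 2 ≤ n then P n hn else idleProgram _ _, ?_⟩
  intro V _ G ids hids hG hcon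
  obtain ⟨S₀, hS₀, hs₀⟩ := exists_card_le_of_iInf_le hcon
  have hn : 2 ≤ Fintype.card V :=
    (one_lt_card_of_not_preconnected hS₀).trans (Fintype.card_subtype_le _)
  beta_reduce
  rw [dif_pos hn]
  obtain ⟨hex, hmin, hsep⟩ := minCut_correspondence ids.injective
    (fun S hS _ => separates_of_isVertexCut hS)
    (fun F hF _ => exists_isVertexCut hF) ⟨S₀, hS₀, hs₀⟩
  have hD := one_le_diam hG hn
  have hΔ := one_le_maxDegree hG hn
  obtain ⟨o, ho, hcut, hknown, hall⟩ := hP _ hn V G ids hids hG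
    (fun R hball hdeg F hF s v hsv => exists_short_walk_vertices hball hdeg hF hsv)
    (fun F hF => by
      refine le_trans ?_ hF
      rw [← Set.ncard_coe_finset, ← Set.ncard_image_of_injective _ ids.injective]
      refine Set.ncard_le_ncard ?_ (Finset.finite_toSet F)
      rintro _ ⟨u, hu, rfl⟩
      exact not_not.mp hu)
    hex (G.diam * G.maxDegree)
    (fun u v => by
      obtain ⟨p, hp⟩ := exists_walk_le_diam hG u v
      exact ⟨p, hp.trans (Nat.le_mul_of_pos_right _ hΔ)⟩)
    (fun v => not_lt.mpr ((ncard_links_le_maxDegree v).trans (Nat.le_mul_of_pos_left _ hD)))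
  intro ω
  exact solvesMinCut hmin hsep (ho ω _ (hc _ (Nat.mul_pos hD hΔ))) hcut hknown hall

theorem SolvesMinCut.ne_none {V X N : Type} [DecidableEq N] {IsMinCut : Finset X → Prop}
    {name : X → N} {out : V → Option (CutOutput N)} (h : SolvesMinCut IsMinCut name out) (v : V) :
    out v ≠ none := by
  obtain ⟨o, ho, -⟩ := h
  rw [ho v]
  exact Option.some_ne_none _


theorem theorem1 (Λ a b : ℕ) :
    (∃ (c B : ℕ) (P : ∀ n : ℕ, CongestProgram (CutOutput (Sym2 ℕ × ℕ)) (B * Nat.clog 2 n)),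
      ∀ (V : Type) [Fintype V] (G : Multigraph V) (ids : V ↪ ℕ),
        (∀ v, ids v < Fintype.card V ^ a) →
        G.graph.Connected →
        G.edgeConnectivity ≤ (Λ : ℕ∞) →
          (P (Fintype.card V)).HaltsWithin G ids (c * G.diam ^ c) ∧
          1 - 1 / (Fintype.card V : ℝ) ^ b ≤
            (P (Fintype.card V)).prob V (fun ω =>
              SolvesMinCut G.IsMinEdgeCut (edgeName ids)
                ((P (Fintype.card V)).outputs G ids ω (c * G.diam ^ c)))) ∧
    (∃ (c B : ℕ) (P : ∀ n : ℕ, CongestProgram (CutOutput ℕ) (B * Nat.clog 2 n)),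
      ∀ (V : Type) [Fintype V] (G : Multigraph V) (ids : V ↪ ℕ),
        (∀ v, ids v < Fintype.card V ^ a) →
        G.graph.Connected →
        G.vertexConnectivity ≤ (Λ : ℕ∞) →
          (P (Fintype.card V)).HaltsWithin G ids (c * (G.diam * G.maxDegree) ^ c) ∧
          1 - 1 / (Fintype.card V : ℝ) ^ b ≤
            (P (Fintype.card V)).prob V (fun ω =>
              SolvesMinCut G.IsMinVertexCut ids
                ((P (Fintype.card V)).outputs G ids ω (c * (G.diam * G.maxDegree) ^ c)))) := by

  constructor
  · obtain ⟨c, B, P, hP⟩ := exists_minEdgeCut_programs Λ a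
    refine ⟨c, B, P, fun V _ G ids hids hG hcon => ?_⟩
    have h := hP V G ids hids hG hcon
    exact CongestProgram.halts_and_prob _ (by positivity) (fun ω => (h ω).ne_none) h
  · obtain ⟨c, B, P, hP⟩ := exists_minVertexCut_programs Λ a
    refine ⟨c, B, P, fun V _ G ids hids hG hcon => ?_⟩
    have h := hP V G ids hids hG hcon
    exact CongestProgram.halts_and_prob _ (by positivity) (fun ω => (h ω).ne_none) h
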